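/- Let $X$ be a real-valued random variable on a probability space. Suppose that (1) $\mathbb{E}\,e^{b|X|^{a}}<\infty$ for some $b>0$ and some $a>1$, and (2) $\mathbb{E}\,e^{b'X^{2}}=\infty$ for every $b'>0$. Then $\mathbb{E}\,e^{zX}$ is well defined (that is, $e^{zX}$ is integrable) for every $z\in\mathbb{C}$, and the function $z\mapsto\mathbb{E}\,e^{zX}$ has a zero that is not purely imaginary: there is $z\in\mathbb{C}$ with $\operatorname{Re} z\neq 0$ and $\mathbb{E}\,e^{zX}=0$. -/

import Mathlib

open MeasureTheory ProbabilityTheory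

open Filter Topology

/-! Suppose every zero of f(z) = E e^{zX} is purely imaginary. By (1), f is entire of finite order.
The even function f(z)f(-z) equals G(z²) with G entire of finite order, G(0) = 1, and only negative
zeros. The inequality |f(z)| ≤ f(Re z) becomes the ridge property |G(r e^{2iβ})| ≤ |G(r cos²β)|, and
Jensen gives |G| ≥ 1 on the positive axis. These facts force |G(r)| ≤ e^{Ar}
(`norm_le_exp_of_ridge`). Jensen's lower bound on f(-t) then yields f(t) ≤ e^{At²+mt} with m = E X,
and integrating against a Gaussian weight in t makes e^{b'X²} integrable for some b' > 0, contrary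
to (2).

The heart is `genusSum_descent`. By Hadamard factorization, log|G| averaged over the angles ±α is a
limit of partial sums of some finite genus. The genus k ≥ 2 can be lowered to k - 1 exactly when the
degree-k coefficient left over in genus k - 1 tends to 0 along the partial sums. If its limit were
negative, log|G| would be at most -εr^k + O(r^{k-1}) on the positive axis, against |G| ≥ 1. If it
were positive, let m be the even one of k - 1, k and β = 2π/(2m+1). On the ray of angle 2β the
powers of degree m and m + 1 both have cosine c = cos β, so log|G| there exceeds its value at r
cos²β by at least (c - c^{2k})εr^k - O(r^{k-1}), against the ridge property. In genus 1 the primary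
logarithms are nonpositive on the positive axis, and only a linear bound remains. -/

/-! ### Weierstrass primary factors along rays -/

/-- The real part of the logarithm of the Weierstrass primary factor of genus `m` with zero `-1`,
at the point `x * exp (α * I)`. -/
noncomputable def primaryLog (m : ℕ) (α x : ℝ) : ℝ :=
  Real.log (1 + 2 * x * Real.cos α + x ^ 2) / 2 +
    ∑ k ∈ Finset.Icc 1 m, (-1) ^ k * (x ^ k * Real.cos (k * α)) / k

theorem one_add_two_mul_cos_add_sq_pos {α x : ℝ} (hα : -1 < Real.cos α) (hx : 0 ≤ x) :
    0 < 1 + 2 * x * Real.cos α + x ^ 2 := by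
  rcases hx.eq_or_lt with rfl | hx
  · norm_num
  · nlinarith [sq_nonneg (1 - x), mul_pos hx (by linarith : (0 : ℝ) < 1 + Real.cos α)]

theorem primaryLog_succ (m : ℕ) (α x : ℝ) :
    primaryLog (m + 1) α x = primaryLog m α x +
      (-1) ^ (m + 1) * (x ^ (m + 1) * Real.cos ((m + 1 : ℕ) * α)) / (m + 1 : ℕ) := by
  unfold primaryLog
  rw [Finset.sum_Icc_succ_top (by omega)]
  ring

theorem primaryLog_zero_right (m : ℕ) (α : ℝ) : primaryLog m α 0 = 0 := by
  induction m with
  | zero => simp [primaryLog]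
  | succ m ih => rw [primaryLog_succ, ih]; simp

/-- The logarithmic derivative of the primary factor telescopes to (-w)^m / (1 + w); this is the
real part of its product with e^{iα}. -/
theorem hasDerivAt_primaryLog (m : ℕ) {α x : ℝ} (hα : -1 < Real.cos α) (hx : 0 ≤ x) :
    HasDerivAt (primaryLog m α)
      ((-1) ^ m * (x ^ m * (Real.cos ((m + 1 : ℕ) * α) + x * Real.cos (m * α))) /
        (1 + 2 * x * Real.cos α + x ^ 2)) x := by
  have hq := one_add_two_mul_cos_add_sq_pos hα hx
  induction m with
  | zero =>
    have h : HasDerivAt (fun x : ℝ => 1 + 2 * x * Real.cos α + x ^ 2)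
        (2 * Real.cos α + 2 * x) x := by
      have h1 := (((hasDerivAt_id x).const_mul 2).mul_const (Real.cos α)).const_add 1
      have h2 := h1.add (hasDerivAt_pow 2 x)
      refine h2.congr_deriv ?_
      simp
    have h2 := (h.log hq.ne').div_const 2
    have h3 : primaryLog 0 α = fun x => Real.log (1 + 2 * x * Real.cos α + x ^ 2) / 2 := by
      funext y; simp [primaryLog]
    rw [h3]
    refine h2.congr_deriv ?_
    simp
    field_simp
  | succ m ih =>
    have h3 : primaryLog (m + 1) α = fun x => primaryLog m α x +
      (-1) ^ (m + 1) * (x ^ (m + 1) * Real.cos ((m + 1 : ℕ) * α)) / (m + 1 : ℕ) := by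
      funext y; rw [primaryLog_succ]
    rw [h3]
    have h4 := ((((hasDerivAt_pow (m + 1) x).mul_const (Real.cos ((m + 1 : ℕ) * α))).const_mul
      ((-1 : ℝ) ^ (m + 1))).div_const ((m + 1 : ℕ) : ℝ))
    refine (ih.add h4).congr_deriv ?_
    have hc : Real.cos ((m + 1 + 1 : ℕ) * α) =
        2 * Real.cos α * Real.cos ((m + 1 : ℕ) * α) - Real.cos (m * α) := by
      have e1 : ((m + 1 + 1 : ℕ) : ℝ) * α = ((m + 1 : ℕ) : ℝ) * α + α := by push_cast; ring
      have e2 : (m : ℝ) * α = ((m + 1 : ℕ) : ℝ) * α - α := by push_cast; ring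
      rw [e1, e2, Real.cos_add, Real.cos_sub]; ring
    rw [hc]
    have hm : ((m + 1 : ℕ) : ℝ) ≠ 0 := by positivity
    generalize hq' : 1 + 2 * x * Real.cos α + x ^ 2 = q at *
    have hq0 := hq.ne'
    simp only [Nat.add_sub_cancel]
    field_simp
    rw [← hq']
    ring

theorem nonneg_of_hasDerivAt_nonneg {g : ℝ → ℝ} {g' : ℝ → ℝ} (hg : ∀ x, 0 ≤ x → HasDerivAt g (g' x) x)
    (h0 : g 0 = 0) (hg' : ∀ x, 0 ≤ x → 0 ≤ g' x) {x : ℝ} (hx : 0 ≤ x) : 0 ≤ g x := by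
  have hm : MonotoneOn g (Set.Ici 0) := by
    refine monotoneOn_of_deriv_nonneg (convex_Ici 0)
      (fun y hy => (hg y hy).continuousAt.continuousWithinAt) ?_ ?_
    · intro y hy
      rw [interior_Ici] at hy
      exact (hg y (le_of_lt hy)).differentiableAt.differentiableWithinAt
    · intro y hy
      rw [interior_Ici] at hy
      rw [(hg y (le_of_lt hy)).deriv]
      exact hg' y (le_of_lt hy)
  have := hm (Set.mem_Ici.2 le_rfl) (Set.mem_Ici.2 hx) hx
  rwa [h0] at this

theorem hasDerivAt_primaryLog_zero (m : ℕ) {x : ℝ} (hx : 0 ≤ x) :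
    HasDerivAt (primaryLog m 0) ((-1) ^ m * (x ^ m / (1 + x))) x := by
  refine (hasDerivAt_primaryLog m (by norm_num) hx).congr_deriv ?_
  have : 1 + x ≠ 0 := by positivity
  have h2 : 1 + 2 * x + x ^ 2 = (1 + x) ^ 2 := by ring
  simp only [mul_zero, Real.cos_zero, mul_one]
  rw [h2]
  field_simp

theorem primaryLog_zero_sign (m : ℕ) {x : ℝ} (hx : 0 ≤ x) : 0 ≤ (-1) ^ m * primaryLog m 0 x := by
  refine nonneg_of_hasDerivAt_nonneg (g := fun x => (-1) ^ m * primaryLog m 0 x)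
    (fun y hy => (hasDerivAt_primaryLog_zero m hy).const_mul _) (by simp [primaryLog_zero_right])
    (fun y hy => ?_) hx
  rw [← mul_assoc, ← mul_pow]
  simp
  positivity

theorem primaryLog_nonneg {m : ℕ} (hm : Even m) {x : ℝ} (hx : 0 ≤ x) : 0 ≤ primaryLog m 0 x := by
  simpa [hm.neg_one_pow] using primaryLog_zero_sign m hx

theorem primaryLog_nonpos {m : ℕ} (hm : Odd m) {x : ℝ} (hx : 0 ≤ x) : primaryLog m 0 x ≤ 0 := by
  simpa [hm.neg_one_pow] using primaryLog_zero_sign m hx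

theorem primaryLog_zero_succ (m : ℕ) (x : ℝ) :
    primaryLog (m + 1) 0 x = primaryLog m 0 x + (-1) ^ (m + 1) * x ^ (m + 1) / (m + 1 : ℕ) := by
  simp [primaryLog_succ]

/-- Removing the top term leaves odd genus m - 1, where the value is nonpositive. -/
theorem primaryLog_le_pow {m : ℕ} (hm : Even m) {x : ℝ} (hx : 0 ≤ x) (h1 : 1 ≤ m) :
    primaryLog m 0 x ≤ x ^ m / m := by
  obtain ⟨k, rfl⟩ := Nat.exists_eq_add_of_le' h1
  have h := primaryLog_nonpos (m := k) (by grind) hx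
  rw [primaryLog_zero_succ, hm.neg_one_pow, one_mul]
  linarith

theorem neg_pow_le_primaryLog {m : ℕ} (hm : Odd m) {x : ℝ} (hx : 0 ≤ x) :
    -(x ^ m / m) ≤ primaryLog m 0 x := by
  obtain ⟨k, rfl⟩ := Nat.exists_eq_add_of_le' hm.pos
  have h := primaryLog_nonneg (m := k) (by grind) hx
  rw [primaryLog_zero_succ, hm.neg_one_pow, neg_one_mul, neg_div]
  linarith

/-- Comparison of derivatives in x, which reduces to q / (1 + xq) ≤ 1 / (1 + x) for q ≤ 1. -/
theorem primaryLog_scale {m : ℕ} (hm : Even m) {q x : ℝ} (hq0 : 0 ≤ q) (hq1 : q ≤ 1) (hx : 0 ≤ x) :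
    primaryLog m 0 (x * q) ≤ q ^ m * primaryLog m 0 x := by
  have key := nonneg_of_hasDerivAt_nonneg
    (g := fun x => q ^ m * primaryLog m 0 x - primaryLog m 0 (x * q))
    (g' := fun x => q ^ m * (x ^ m / (1 + x)) - ((x * q) ^ m / (1 + x * q)) * q) ?_
    (by simp [primaryLog_zero_right]) ?_ hx
  · linarith
  · intro y hy
    have h1 := (hasDerivAt_primaryLog_zero m hy).const_mul (q ^ m)
    have h2 : HasDerivAt (fun x => primaryLog m 0 (x * q))
        ((-1) ^ m * ((y * q) ^ m / (1 + y * q)) * q) y :=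
      HasDerivAt.comp (h := fun x => x * q) y
        (hasDerivAt_primaryLog_zero m (mul_nonneg hy hq0)) (hasDerivAt_mul_const q)
    refine (h1.sub h2).congr_deriv ?_
    rw [hm.neg_one_pow]; ring
  · intro y hy
    have hyq := mul_nonneg hy hq0
    have : q / (1 + y * q) ≤ 1 / (1 + y) := by
      rw [div_le_div_iff₀ (by positivity) (by positivity)]
      nlinarith
    have h3 := mul_le_mul_of_nonneg_left this (by positivity : 0 ≤ (y * q) ^ m)
    have e1 : (y * q) ^ m * (q / (1 + y * q)) = (y * q) ^ m / (1 + y * q) * q := by ring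
    have e2 : (y * q) ^ m * (1 / (1 + y)) = q ^ m * (y ^ m / (1 + y)) := by rw [mul_pow]; ring
    linarith

/-! ### The balanced ray -/

/-- The half-angle at which the terms of degree `m` and `m + 1` are balanced. -/
noncomputable def balancedAngle (m : ℕ) : ℝ := 2 * Real.pi / (2 * m + 1)

theorem balancedAngle_pos (m : ℕ) : 0 < balancedAngle m := by
  unfold balancedAngle; positivity

theorem balancedAngle_lt {m : ℕ} (hm : 2 ≤ m) : balancedAngle m < Real.pi / 2 := by
  unfold balancedAngle
  have : (2 : ℝ) ≤ m := by exact_mod_cast hm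
  rw [div_lt_div_iff₀ (by positivity) (by positivity)]
  nlinarith [Real.pi_pos]

theorem cos_balancedAngle_pos {m : ℕ} (hm : 2 ≤ m) : 0 < Real.cos (balancedAngle m) :=
  Real.cos_pos_of_mem_Ioo ⟨by linarith [balancedAngle_pos m, Real.pi_pos], balancedAngle_lt hm⟩

theorem cos_balancedAngle_lt_one {m : ℕ} (hm : 2 ≤ m) : Real.cos (balancedAngle m) < 1 := by
  rw [← Real.cos_zero]
  exact Real.cos_lt_cos_of_nonneg_of_le_pi le_rfl
    (by linarith [balancedAngle_lt hm, Real.pi_pos]) (balancedAngle_pos m)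

theorem cos_mul_two_balancedAngle (m : ℕ) :
    Real.cos (m * (2 * balancedAngle m)) = Real.cos (balancedAngle m) := by
  have : (m : ℝ) * (2 * balancedAngle m) = 2 * Real.pi - balancedAngle m := by
    unfold balancedAngle; field_simp; ring
  rw [this, Real.cos_two_pi_sub]

theorem cos_succ_mul_two_balancedAngle (m : ℕ) :
    Real.cos ((m + 1 : ℕ) * (2 * balancedAngle m)) = Real.cos (balancedAngle m) := by
  have : ((m + 1 : ℕ) : ℝ) * (2 * balancedAngle m) = balancedAngle m + 2 * Real.pi := by
    unfold balancedAngle; push_cast; field_simp; ring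
  rw [this, Real.cos_add_two_pi]

theorem neg_one_lt_cos_two_balancedAngle {m : ℕ} (hm : 2 ≤ m) :
    -1 < Real.cos (2 * balancedAngle m) := by
  rw [Real.cos_two_mul]
  nlinarith [cos_balancedAngle_pos hm]

/-- On the balanced ray both cosines in the derivative equal cos β, so its numerator is cos β · y^m
(1 + y). The claim then follows from |1 + y e^{2iβ}| ≤ 1 + y. -/
theorem le_primaryLog_balancedAngle {m : ℕ} (hm : Even m) (h2 : 2 ≤ m) {x : ℝ} (hx : 0 ≤ x) :
    Real.cos (balancedAngle m) * primaryLog m 0 x ≤ primaryLog m (2 * balancedAngle m) x := by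
  have hα := neg_one_lt_cos_two_balancedAngle h2
  have hc := cos_balancedAngle_pos h2
  have key := nonneg_of_hasDerivAt_nonneg
    (g := fun x => primaryLog m (2 * balancedAngle m) x -
      Real.cos (balancedAngle m) * primaryLog m 0 x)
    (fun y hy => (hasDerivAt_primaryLog m hα hy).sub
      ((hasDerivAt_primaryLog_zero m hy).const_mul (Real.cos (balancedAngle m))))
    (by simp [primaryLog_zero_right]) ?_ hx
  · linarith
  · intro y hy
    have hq := one_add_two_mul_cos_add_sq_pos hα hy
    rw [cos_mul_two_balancedAngle, cos_succ_mul_two_balancedAngle, hm.neg_one_pow]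
    have h1 : 1 / (1 + y) ≤ (1 + y) / (1 + 2 * y * Real.cos (2 * balancedAngle m) + y ^ 2) := by
      rw [div_le_div_iff₀ (by positivity) hq]
      nlinarith [Real.cos_le_one (2 * balancedAngle m)]
    have h3 := mul_le_mul_of_nonneg_left h1
      (by positivity : 0 ≤ Real.cos (balancedAngle m) * y ^ m)
    have e1 : Real.cos (balancedAngle m) * y ^ m * (1 / (1 + y)) =
      Real.cos (balancedAngle m) * (1 * (y ^ m / (1 + y))) := by ring
    have e2 : Real.cos (balancedAngle m) * y ^ m *
        ((1 + y) / (1 + 2 * y * Real.cos (2 * balancedAngle m) + y ^ 2)) =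
      1 * (y ^ m * (Real.cos (balancedAngle m) + y * Real.cos (balancedAngle m))) /
        (1 + 2 * y * Real.cos (2 * balancedAngle m) + y ^ 2) := by ring
    linarith

/-! ### Partial Hadamard sums and their coefficients -/

/-- Partial sum of the logarithm of a canonical product of genus `N` with zeros `-s`, `s ∈ Z`, of
multiplicity `ν s`, and exponential factor `∑ p k * w ^ k`, at `w = r * exp (α * I)`. -/
noncomputable def genusSum (Z : Finset ℝ) (ν : ℝ → ℕ) (p : ℕ → ℝ) (N : ℕ) (r α : ℝ) : ℝ :=
  ∑ k ∈ Finset.Icc 1 N, p k * (r ^ k * Real.cos (k * α)) +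
    ∑ s ∈ Z, ν s * primaryLog N α (r / s)

/-- The coefficient of degree `k` of the exponential factor of a product of genus less than `k`. -/
noncomputable def genusCoeff (Z : Finset ℝ) (ν : ℝ → ℕ) (p : ℕ → ℝ) (k : ℕ) : ℝ :=
  p k + (-1) ^ k / k * ∑ s ∈ Z, ν s / s ^ k

/-- The top terms of all primary factors merge with `p (N + 1)` into one coefficient; the descent
consists in showing that it vanishes in the limit. -/
theorem genusSum_succ (Z : Finset ℝ) (ν : ℝ → ℕ) (p : ℕ → ℝ) (N : ℕ) (r α : ℝ) :
    genusSum Z ν p (N + 1) r α = genusSum Z ν p N r α +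
      genusCoeff Z ν p (N + 1) * (r ^ (N + 1) * Real.cos ((N + 1 : ℕ) * α)) := by
  unfold genusSum genusCoeff
  rw [Finset.sum_Icc_succ_top (by omega)]
  simp only [primaryLog_succ, mul_add, Finset.sum_add_distrib, add_mul]
  have : ∑ s ∈ Z, (ν s : ℝ) * ((-1) ^ (N + 1) * ((r / s) ^ (N + 1) * Real.cos ((N + 1 : ℕ) * α)) /
      (N + 1 : ℕ)) = (-1) ^ (N + 1) / (N + 1 : ℕ) * (∑ s ∈ Z, (ν s : ℝ) / s ^ (N + 1)) *
        (r ^ (N + 1) * Real.cos ((N + 1 : ℕ) * α)) := by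
    rw [Finset.mul_sum, Finset.sum_mul]
    refine Finset.sum_congr rfl fun s _ => ?_
    rw [div_pow]; ring
  rw [this]; ring

theorem sum_mul_pow_le {N : ℕ} (p θ : ℕ → ℝ) {C : ℝ} (hθ : ∀ k, |θ k| ≤ C) {r : ℝ} (hr : 1 ≤ r) :
    |∑ k ∈ Finset.Icc 1 N, p k * (r ^ k * θ k)| ≤ (∑ k ∈ Finset.Icc 1 N, |p k|) * C * r ^ N := by
  have hC : 0 ≤ C := (abs_nonneg _).trans (hθ 0)
  rw [Finset.sum_mul, Finset.sum_mul]
  refine (Finset.abs_sum_le_sum_abs _ _).trans (Finset.sum_le_sum fun k hk => ?_)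
  rw [abs_mul, abs_mul, abs_of_nonneg (by positivity : 0 ≤ r ^ k), mul_assoc, mul_comm C]
  have := pow_le_pow_right₀ hr (Finset.mem_Icc.1 hk).2
  gcongr
  exact hθ k

theorem not_forall_mul_pow_succ_le {ε B : ℝ} (hε : 0 < ε) (N : ℕ)
    (h : ∀ r : ℝ, 1 ≤ r → ε * r ^ (N + 1) ≤ B * r ^ N) : False := by
  have h1 := h (max 1 (B / ε + 1)) (le_max_left _ _)
  set r := max 1 (B / ε + 1)
  have hr : 0 < r := lt_of_lt_of_le one_pos (le_max_left _ _)
  rw [pow_succ, mul_comm (r ^ N), ← mul_assoc] at h1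
  have h2 := le_of_mul_le_mul_right h1 (by positivity)
  have h3 : B / ε + 1 ≤ r := le_max_right _ _
  have h4 : B + ε ≤ ε * r := by
    calc B + ε = ε * (B / ε + 1) := by field_simp
      _ ≤ ε * r := by gcongr
  linarith

theorem tendsto_zero_of_monotone {u : ℕ → ℝ} (hu : Monotone u) (h1 : ∀ n, u n ≤ 0)
    (h2 : ∀ ε, 0 < ε → ∃ n, -ε < u n) : Tendsto u atTop (𝓝 0) := by
  rw [Metric.tendsto_atTop]
  intro ε hε
  obtain ⟨n, hn⟩ := h2 ε hε
  refine ⟨n, fun m hm => ?_⟩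
  rw [Real.dist_eq, sub_zero, abs_lt]
  exact ⟨hn.trans_le (hu hm), (h1 m).trans_lt hε⟩

/-! ### Lowering the genus by positivity and the ridge property -/

section Descent

variable {Z : ℕ → Finset ℝ} {ν : ℝ → ℕ} {p : ℕ → ℝ} {U : ℝ → ℝ → ℝ} {M : ℕ}

theorem sum_mono_of_nonneg (hZ : Monotone Z) (hpos : ∀ n, ∀ s ∈ Z n, 0 < s) {g : ℝ → ℝ}
    (hg : ∀ s, 0 < s → 0 ≤ g s) : Monotone fun n => ∑ s ∈ Z n, ν s * g s := by
  intro a b hab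
  refine Finset.sum_le_sum_of_subset_of_nonneg (hZ hab) fun s hs _ => ?_
  have := hg s (hpos b s hs)
  positivity

theorem monotone_genusCoeff (hZ : Monotone Z) (hpos : ∀ n, ∀ s ∈ Z n, 0 < s) {k : ℕ}
    (hk : Even k) : Monotone fun n => genusCoeff (Z n) ν p k := by
  have h := sum_mono_of_nonneg (ν := ν) hZ hpos (g := fun s => 1 / s ^ k)
    (fun s hs => by positivity)
  intro a b hab
  have := h hab
  simp only [mul_one_div] at this
  simp only [genusCoeff, hk.neg_one_pow]
  gcongr

theorem antitone_genusCoeff (hZ : Monotone Z) (hpos : ∀ n, ∀ s ∈ Z n, 0 < s) {k : ℕ}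
    (hk : Odd k) : Antitone fun n => genusCoeff (Z n) ν p k := by
  have h := sum_mono_of_nonneg (ν := ν) hZ hpos (g := fun s => 1 / s ^ k)
    (fun s hs => by positivity)
  intro a b hab
  have := h hab
  simp only [mul_one_div] at this
  simp only [genusCoeff, hk.neg_one_pow]
  have h2 := mul_le_mul_of_nonneg_left this (by positivity : (0 : ℝ) ≤ 1 / k)
  rw [neg_div, neg_mul, neg_mul]
  linarith

theorem sum_primaryLog_zero_succ (Z : Finset ℝ) (ν : ℝ → ℕ) (p : ℕ → ℝ) (N : ℕ) (r : ℝ) :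
    p (N + 1) * r ^ (N + 1) + ∑ s ∈ Z, ν s * primaryLog (N + 1) 0 (r / s) =
      genusCoeff Z ν p (N + 1) * r ^ (N + 1) + ∑ s ∈ Z, ν s * primaryLog N 0 (r / s) := by
  have h := genusSum_succ Z ν p N r 0
  unfold genusSum at h
  rw [Finset.sum_Icc_succ_top (by omega)] at h
  simp only [mul_zero, Real.cos_zero, mul_one] at h
  linarith

theorem sum_mul_div_pow (Z : Finset ℝ) (ν : ℝ → ℕ) (N : ℕ) (r : ℝ) :
    ∑ s ∈ Z, ν s * ((r / s) ^ N / N) = (∑ s ∈ Z, ν s / s ^ N / N) * r ^ N := by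
  rw [Finset.sum_mul]
  refine Finset.sum_congr rfl fun s _ => ?_
  rw [div_pow]; ring

/-- Along a balanced ray a product of even genus dominates its values on the positive axis. -/
theorem balanced_primaryLog_sub_ge {m : ℕ} (hm : Even m) (h2 : 2 ≤ m) {x : ℝ} (hx : 0 ≤ x) :
    (Real.cos (balancedAngle m) - (Real.cos (balancedAngle m) ^ 2) ^ m) * primaryLog m 0 x ≤
      primaryLog m (2 * balancedAngle m) x -
        primaryLog m 0 (x * Real.cos (balancedAngle m) ^ 2) := by
  have hc0 := cos_balancedAngle_pos h2
  have hc1 := cos_balancedAngle_lt_one h2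
  have h3 := le_primaryLog_balancedAngle hm h2 hx
  have h4 := primaryLog_scale hm (q := Real.cos (balancedAngle m) ^ 2) (by positivity)
    (pow_le_one₀ hc0.le hc1.le) hx
  linarith

theorem cos_balancedAngle_gap {m k : ℕ} (h2 : 2 ≤ m) (hk : 1 ≤ k) :
    0 < Real.cos (balancedAngle m) - (Real.cos (balancedAngle m) ^ 2) ^ k := by
  have hc0 := cos_balancedAngle_pos h2
  have hc1 := cos_balancedAngle_lt_one h2
  rw [← pow_mul, sub_pos]
  calc _ < Real.cos (balancedAngle m) ^ 1 := pow_lt_pow_right_of_lt_one₀ hc0 hc1 (by omega)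
    _ = _ := pow_one _

theorem abs_cos_sub_pow_le {q t : ℝ} (hq0 : 0 ≤ q) (hq1 : q ≤ 1) (k : ℕ) :
    |Real.cos t - q ^ k| ≤ 2 := by
  have h1 := Real.neg_one_le_cos t
  have h2 := Real.cos_le_one t
  have h3 := pow_le_one₀ hq0 hq1 (n := k)
  have h4 := pow_nonneg hq0 k
  rw [abs_le]; constructor <;> linarith

theorem tendsto_genusCoeff_even (hZ : Monotone Z) (hpos : ∀ n, ∀ s ∈ Z n, 0 < s)
    (hU0 : ∀ r, 0 ≤ r → 0 ≤ U r 0)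
    (hUr : ∀ r β, 0 ≤ r → 0 < β → β < Real.pi / 2 → U r (2 * β) ≤ U (r * Real.cos β ^ 2) 0)
    (hrep : ∀ r α, 0 ≤ r → 0 ≤ α → α < Real.pi →
      Tendsto (fun n => genusSum (Z n) ν p (M + 1) r α) atTop (𝓝 (U r α)))
    (hM : Even (M + 1)) : Tendsto (fun n => genusCoeff (Z n) ν p (M + 1)) atTop (𝓝 0) := by
  have hM1 : 1 ≤ M := by rcases M with _ | M <;> [(exact absurd hM (by decide)); omega]
  have hModd : Odd M := by grind
  have hmono := monotone_genusCoeff (ν := ν) (p := p) hZ hpos hM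
  have hc0 := cos_balancedAngle_pos (m := M + 1) (by omega)
  have hc1 := cos_balancedAngle_lt_one (m := M + 1) (by omega)
  have hD := cos_balancedAngle_gap (m := M + 1) (k := M + 1) (by omega) (by omega)
  have hβ0 := balancedAngle_pos (M + 1)
  have hβ1 := balancedAngle_lt (m := M + 1) (by omega)
  have hcos := cos_mul_two_balancedAngle (M + 1)
  have hgap := fun (x : ℝ) (hx : 0 ≤ x) =>
    balanced_primaryLog_sub_ge hM (by omega : 2 ≤ M + 1) hx
  set β := balancedAngle (M + 1)
  set c := Real.cos β
  refine tendsto_zero_of_monotone hmono ?_ ?_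
  -- A positive coefficient at stage `n₀` violates the ridge inequality on the balanced ray as r
  -- grows.
  · intro n₀
    by_contra! hn
    refine not_forall_mul_pow_succ_le (mul_pos hD hn) M
      (B := (∑ k ∈ Finset.Icc 1 M, |p k|) * 2 +
        (c - (c ^ 2) ^ (M + 1)) * ∑ s ∈ Z n₀, ν s / s ^ M / M) fun r hr => ?_
    have hr0 : 0 ≤ r := by linarith
    have hlim := (hrep r (2 * β) hr0 (by linarith) (by linarith)).sub
      (hrep (r * c ^ 2) 0 (by positivity) le_rfl Real.pi_pos)
    have hle := sub_nonpos.2 (hUr r β hr0 hβ0 hβ1)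
    have hge := ge_of_tendsto (b := (c - (c ^ 2) ^ (M + 1)) * genusCoeff (Z n₀) ν p (M + 1) *
      r ^ (M + 1) - ((∑ k ∈ Finset.Icc 1 M, |p k|) * 2 +
        (c - (c ^ 2) ^ (M + 1)) * ∑ s ∈ Z n₀, ν s / s ^ M / M) * r ^ M) hlim ?_
    · linarith
    filter_upwards [eventually_ge_atTop n₀] with n hn
    have h1 := sum_mul_pow_le (N := M) p (fun k => Real.cos (k * (2 * β)) - (c ^ 2) ^ k)
      (fun k => abs_cos_sub_pow_le (by positivity) (pow_le_one₀ hc0.le hc1.le) k) hr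
    have h2 : (c - (c ^ 2) ^ (M + 1)) * ∑ s ∈ Z n, ν s * primaryLog (M + 1) 0 (r / s) ≤
        ∑ s ∈ Z n, ν s * primaryLog (M + 1) (2 * β) (r / s) -
          ∑ s ∈ Z n, ν s * primaryLog (M + 1) 0 (r * c ^ 2 / s) := by
      rw [Finset.mul_sum, ← Finset.sum_sub_distrib]
      refine Finset.sum_le_sum fun s hs => ?_
      have := mul_le_mul_of_nonneg_left (hgap (r / s) (div_nonneg hr0 (hpos n s hs).le))
        (Nat.cast_nonneg (α := ℝ) (ν s))
      rw [show r * c ^ 2 / s = r / s * c ^ 2 by ring]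
      linarith
    -- In even genus the primary logarithms are nonnegative, so the sum may be cut down to the fixed
    -- set `Z n₀`. Only there is it rewritten in genus M, with an error O(r^M) that does not depend
    -- on n.
    have h3 := sum_mono_of_nonneg (ν := ν) hZ hpos (g := fun s => primaryLog (M + 1) 0 (r / s))
      (fun s hs => primaryLog_nonneg hM (by positivity)) hn
    have h4 : -((∑ s ∈ Z n₀, ν s / s ^ M / M) * r ^ M) ≤
        ∑ s ∈ Z n₀, ν s * primaryLog M 0 (r / s) := by
      rw [← sum_mul_div_pow, ← Finset.sum_neg_distrib]
      refine Finset.sum_le_sum fun s hs => ?_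
      have := mul_le_mul_of_nonneg_left (neg_pow_le_primaryLog hModd
        (div_nonneg hr0 (hpos n₀ s hs).le)) (Nat.cast_nonneg (α := ℝ) (ν s))
      linarith
    have h5 := sum_primaryLog_zero_succ (Z n₀) ν p M r
    have h6 : genusSum (Z n) ν p (M + 1) r (2 * β) - genusSum (Z n) ν p (M + 1) (r * c ^ 2) 0 =
        ∑ k ∈ Finset.Icc 1 M, p k * (r ^ k * (Real.cos (k * (2 * β)) - (c ^ 2) ^ k)) +
        (c - (c ^ 2) ^ (M + 1)) * (p (M + 1) * r ^ (M + 1)) +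
        (∑ s ∈ Z n, ν s * primaryLog (M + 1) (2 * β) (r / s) -
          ∑ s ∈ Z n, ν s * primaryLog (M + 1) 0 (r * c ^ 2 / s)) := by
      unfold genusSum
      rw [Finset.sum_Icc_succ_top (by omega), Finset.sum_Icc_succ_top (by omega), hcos]
      have : ∑ k ∈ Finset.Icc 1 M, p k * (r ^ k * (Real.cos (k * (2 * β)) - (c ^ 2) ^ k)) =
          ∑ k ∈ Finset.Icc 1 M, p k * (r ^ k * Real.cos (k * (2 * β))) -
          ∑ k ∈ Finset.Icc 1 M, p k * ((r * c ^ 2) ^ k * Real.cos (k * 0)) := by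
        rw [← Finset.sum_sub_distrib]
        refine Finset.sum_congr rfl fun k _ => ?_
        simp [mul_pow]; ring
      rw [this]
      simp [mul_pow]; ring
    have h7 := (abs_le.1 h1).1
    have h8 := mul_le_mul_of_nonneg_left (add_le_add_right h3 (p (M + 1) * r ^ (M + 1))) hD.le
    have h9 := mul_le_mul_of_nonneg_left h4 hD.le
    simp only at h8
    rw [h5] at h8
    rw [h6]
    nlinarith
  -- Coefficients all at most -ε would make U(r, 0) negative for large r: the genus-M terms are
  -- nonpositive since M is odd.
  · intro ε hε
    by_contra! hn
    refine not_forall_mul_pow_succ_le hε M (B := (∑ k ∈ Finset.Icc 1 M, |p k|) * 1) fun r hr => ?_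
    have hr0 : 0 ≤ r := by linarith
    have hle := le_of_tendsto (b := (∑ k ∈ Finset.Icc 1 M, |p k|) * 1 * r ^ M - ε * r ^ (M + 1))
      (hrep r 0 hr0 le_rfl Real.pi_pos) ?_
    · linarith [hU0 r hr0]
    filter_upwards with n
    have h1 := (abs_le.1 (sum_mul_pow_le (N := M) p (fun k => Real.cos (k * 0)) (C := 1)
      (fun k => by simp) hr)).2
    have h5 := genusSum_succ (Z n) ν p M r 0
    have h2 : ∑ s ∈ Z n, ν s * primaryLog M 0 (r / s) ≤ 0 :=
      Finset.sum_nonpos fun s hs => mul_nonpos_of_nonneg_of_nonpos (Nat.cast_nonneg _)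
        (primaryLog_nonpos hModd (div_nonneg hr0 (hpos n s hs).le))
    have h3 := mul_le_mul_of_nonneg_right (hn n) (by positivity : 0 ≤ r ^ (M + 1))
    simp only [mul_zero, Real.cos_zero, mul_one] at h5 h1
    unfold genusSum at h5 ⊢
    simp only [mul_zero, Real.cos_zero, mul_one] at h5 ⊢
    linarith

/-- The even argument with roles exchanged: the coefficients now decrease, positivity of U on the
axis excludes negative ones, and the ridge inequality excludes a positive lower bound. The balanced
angle is that of the even number M; it also balances degree M + 1. -/
theorem tendsto_genusCoeff_odd (hZ : Monotone Z) (hpos : ∀ n, ∀ s ∈ Z n, 0 < s)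
    (hU0 : ∀ r, 0 ≤ r → 0 ≤ U r 0)
    (hUr : ∀ r β, 0 ≤ r → 0 < β → β < Real.pi / 2 → U r (2 * β) ≤ U (r * Real.cos β ^ 2) 0)
    (hrep : ∀ r α, 0 ≤ r → 0 ≤ α → α < Real.pi →
      Tendsto (fun n => genusSum (Z n) ν p (M + 1) r α) atTop (𝓝 (U r α)))
    (hM : Odd (M + 1)) (hM1 : 1 ≤ M) :
    Tendsto (fun n => genusCoeff (Z n) ν p (M + 1)) atTop (𝓝 0) := by
  have hMev : Even M := by grind
  have hM2 : 2 ≤ M := by grind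
  have hanti := antitone_genusCoeff (ν := ν) (p := p) hZ hpos hM
  have hc0 := cos_balancedAngle_pos hM2
  have hc1 := cos_balancedAngle_lt_one hM2
  have hD := cos_balancedAngle_gap (k := M + 1) hM2 (by omega)
  have hD' := cos_balancedAngle_gap (k := M) hM2 (by omega)
  have hβ0 := balancedAngle_pos M
  have hβ1 := balancedAngle_lt hM2
  have hcos := cos_succ_mul_two_balancedAngle M
  have hgap := fun (x : ℝ) (hx : 0 ≤ x) => balanced_primaryLog_sub_ge hMev hM2 hx
  set β := balancedAngle M
  set c := Real.cos β
  rw [← neg_zero]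
  refine (tendsto_zero_of_monotone (u := fun n => -genusCoeff (Z n) ν p (M + 1)) hanti.neg
    ?_ ?_).neg.congr fun n => neg_neg _
  · intro n₀
    by_contra! hn
    refine not_forall_mul_pow_succ_le hn M
      (B := (∑ k ∈ Finset.Icc 1 M, |p k|) * 1 + ∑ s ∈ Z n₀, ν s / s ^ M / M) fun r hr => ?_
    have hr0 : 0 ≤ r := by linarith
    have hle := le_of_tendsto (b := ((∑ k ∈ Finset.Icc 1 M, |p k|) * 1 +
      ∑ s ∈ Z n₀, ν s / s ^ M / M) * r ^ M + genusCoeff (Z n₀) ν p (M + 1) * r ^ (M + 1))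
      (hrep r 0 hr0 le_rfl Real.pi_pos) ?_
    · linarith [hU0 r hr0]
    filter_upwards [eventually_ge_atTop n₀] with n hn
    have h1 := (abs_le.1 (sum_mul_pow_le (N := M) p (fun k => Real.cos (k * 0)) (C := 1)
      (fun k => by simp) hr)).2
    have h3 := sum_mono_of_nonneg (ν := ν) hZ hpos (g := fun s => -primaryLog (M + 1) 0 (r / s))
      (fun s hs => neg_nonneg.2 (primaryLog_nonpos hM (by positivity))) hn
    simp only [mul_neg, Finset.sum_neg_distrib] at h3
    have h4 : ∑ s ∈ Z n₀, ν s * primaryLog M 0 (r / s) ≤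
        (∑ s ∈ Z n₀, ν s / s ^ M / M) * r ^ M := by
      rw [← sum_mul_div_pow]
      refine Finset.sum_le_sum fun s hs => ?_
      exact mul_le_mul_of_nonneg_left (primaryLog_le_pow hMev
        (div_nonneg hr0 (hpos n₀ s hs).le) hM1) (Nat.cast_nonneg (α := ℝ) (ν s))
    have h5 := sum_primaryLog_zero_succ (Z n₀) ν p M r
    unfold genusSum
    rw [Finset.sum_Icc_succ_top (by omega)]
    simp only [mul_zero, Real.cos_zero, mul_one] at h1 ⊢
    linarith
  · intro ε hε
    by_contra! hn
    simp only [neg_le_neg_iff] at hn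
    refine not_forall_mul_pow_succ_le (mul_pos hD hε) M
      (B := (∑ k ∈ Finset.Icc 1 M, |p k|) * 2) fun r hr => ?_
    have hr0 : 0 ≤ r := by linarith
    have hlim := (hrep r (2 * β) hr0 (by linarith) (by linarith)).sub
      (hrep (r * c ^ 2) 0 (by positivity) le_rfl Real.pi_pos)
    have hle := sub_nonpos.2 (hUr r β hr0 hβ0 hβ1)
    have hge := ge_of_tendsto (b := (c - (c ^ 2) ^ (M + 1)) * ε *
      r ^ (M + 1) - ((∑ k ∈ Finset.Icc 1 M, |p k|) * 2) * r ^ M) hlim ?_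
    · linarith
    filter_upwards with n
    have h1 := sum_mul_pow_le (N := M) p (fun k => Real.cos (k * (2 * β)) - (c ^ 2) ^ k)
      (fun k => abs_cos_sub_pow_le (by positivity) (pow_le_one₀ hc0.le hc1.le) k) hr
    -- The genus-M primary logarithms only help and are discarded; the ε term alone gives the
    -- contradiction.
    have h2 : 0 ≤ ∑ s ∈ Z n, ν s * primaryLog M (2 * β) (r / s) -
          ∑ s ∈ Z n, ν s * primaryLog M 0 (r * c ^ 2 / s) := by
      rw [← Finset.sum_sub_distrib]
      refine Finset.sum_nonneg fun s hs => ?_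
      have hx := div_nonneg hr0 (hpos n s hs).le
      have := mul_nonneg (Nat.cast_nonneg (α := ℝ) (ν s))
        ((mul_nonneg hD'.le (primaryLog_nonneg hMev hx)).trans (hgap (r / s) hx))
      rw [show r * c ^ 2 / s = r / s * c ^ 2 by ring]
      linarith
    have h6 : genusSum (Z n) ν p (M + 1) r (2 * β) - genusSum (Z n) ν p (M + 1) (r * c ^ 2) 0 =
        ∑ k ∈ Finset.Icc 1 M, p k * (r ^ k * (Real.cos (k * (2 * β)) - (c ^ 2) ^ k)) +
        (c - (c ^ 2) ^ (M + 1)) * genusCoeff (Z n) ν p (M + 1) * r ^ (M + 1) +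
        (∑ s ∈ Z n, ν s * primaryLog M (2 * β) (r / s) -
          ∑ s ∈ Z n, ν s * primaryLog M 0 (r * c ^ 2 / s)) := by
      rw [genusSum_succ, genusSum_succ, hcos]
      unfold genusSum
      have : ∑ k ∈ Finset.Icc 1 M, p k * (r ^ k * (Real.cos (k * (2 * β)) - (c ^ 2) ^ k)) =
          ∑ k ∈ Finset.Icc 1 M, p k * (r ^ k * Real.cos (k * (2 * β))) -
          ∑ k ∈ Finset.Icc 1 M, p k * ((r * c ^ 2) ^ k * Real.cos (k * 0)) := by
        rw [← Finset.sum_sub_distrib]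
        refine Finset.sum_congr rfl fun k _ => ?_
        simp [mul_pow]; ring
      rw [this]
      simp [mul_pow]; ring
    have h7 := (abs_le.1 h1).1
    have h8 := mul_le_mul_of_nonneg_right (mul_le_mul_of_nonneg_left (hn n) hD.le)
      (by positivity : 0 ≤ r ^ (M + 1))
    rw [h6]
    linarith

theorem genusSum_descent (hZ : Monotone Z) (hpos : ∀ n, ∀ s ∈ Z n, 0 < s)
    (hU0 : ∀ r, 0 ≤ r → 0 ≤ U r 0)
    (hUr : ∀ r β, 0 ≤ r → 0 < β → β < Real.pi / 2 → U r (2 * β) ≤ U (r * Real.cos β ^ 2) 0)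
    (hrep : ∀ r α, 0 ≤ r → 0 ≤ α → α < Real.pi →
      Tendsto (fun n => genusSum (Z n) ν p (M + 1) r α) atTop (𝓝 (U r α)))
    {r : ℝ} (hr : 0 ≤ r) : U r 0 ≤ p 1 * r := by
  induction M with
  | zero =>
    refine le_of_tendsto (hrep r 0 hr le_rfl Real.pi_pos) (Eventually.of_forall fun n => ?_)
    have h2 : ∑ s ∈ Z n, ν s * primaryLog 1 0 (r / s) ≤ 0 :=
      Finset.sum_nonpos fun s hs => mul_nonpos_of_nonneg_of_nonpos (Nat.cast_nonneg _)
        (primaryLog_nonpos odd_one (div_nonneg hr (hpos n s hs).le))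
    unfold genusSum
    simpa using h2
  | succ M ih =>
    refine ih fun r α hr hα0 hα1 => ?_
    have h : Tendsto (fun n => genusCoeff (Z n) ν p (M + 1 + 1)) atTop (𝓝 0) := by
      rcases Nat.even_or_odd (M + 1 + 1) with h | h
      · exact tendsto_genusCoeff_even hZ hpos hU0 hUr hrep h
      · exact tendsto_genusCoeff_odd hZ hpos hU0 hUr hrep h (by omega)
    have h2 := (hrep r α hr hα0 hα1).sub
      (h.mul_const (r ^ (M + 1 + 1) * Real.cos ((M + 1 + 1 : ℕ) * α)))
    rw [zero_mul, sub_zero] at h2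
    refine h2.congr fun n => ?_
    rw [genusSum_succ]; ring

end Descent

/-! ### Zeros, logarithms and Taylor tails of entire functions -/

theorem Differentiable.exists_eq_pow_mul {G : ℂ → ℂ} (hG : Differentiable ℂ G) (a : ℂ)
    (hne : ∃ w, G w ≠ 0) :
    ∃ g : ℂ → ℂ, Differentiable ℂ g ∧ g a ≠ 0 ∧
      ∀ w, G w = (w - a) ^ analyticOrderNatAt G a * g w := by
  have han : AnalyticAt ℂ G a := hG.analyticAt a
  obtain ⟨p, hp⟩ := han
  have hp0 : p ≠ 0 := by
    intro h
    obtain ⟨w, hw⟩ := hne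
    have h1 := hp.locally_zero_iff.2 h
    have h2 := AnalyticOnNhd.eq_of_eventuallyEq (f := G) (g := 0)
      (fun z _ => hG.analyticAt z) (fun z _ => analyticAt_const) h1
    exact hw (by rw [h2]; rfl)
  have hd : Differentiable ℂ ((Function.swap dslope a)^[p.order] G) := by
    generalize p.order = n
    induction n with
    | zero => exact hG
    | succ n ih =>
      rw [Function.iterate_succ_apply']
      have := (Complex.differentiableOn_dslope (c := a) (s := Set.univ) Filter.univ_mem).2
        ih.differentiableOn
      exact differentiableOn_univ.1 this
  have hn := hp.iterate_dslope_fslope_ne_zero hp0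
  have heq := hp.eq_pow_order_mul_iterate_dslope
  have hord : analyticOrderAt G a = p.order :=
    ((hG.analyticAt a).analyticOrderAt_eq_natCast).2
      ⟨_, hd.analyticAt a, hn, Eventually.of_forall heq⟩
  refine ⟨_, hd, hn, fun w => ?_⟩
  rw [analyticOrderNatAt, hord, ENat.toNat_natCast]
  exact heq w

theorem one_add_div_ne_zero {s : ℝ} (hs : 0 < s) {w : ℂ} (hw : w ≠ -(s : ℂ)) :
    1 + w / s ≠ 0 := by
  have hs' : (s : ℂ) ≠ 0 := by exact_mod_cast hs.ne'
  intro h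
  apply hw
  field_simp at h
  linear_combination h

theorem analyticOrderNatAt_mul_of_ne_zero {f g : ℂ → ℂ} {a : ℂ} (hf : AnalyticAt ℂ f a)
    (hg : AnalyticAt ℂ g a) (h : f a ≠ 0) :
    analyticOrderNatAt (fun w => f w * g w) a = analyticOrderNatAt g a := by
  have h1 : analyticOrderAt f a = 0 := hf.analyticOrderAt_eq_zero.2 h
  have h2 := analyticOrderAt_mul hf hg
  rw [h1, zero_add] at h2
  exact congrArg ENat.toNat h2

/-- Extraction of finitely many negative real zeros from an entire function. -/
theorem Differentiable.exists_eq_prod_mul {G : ℂ → ℂ} (hG : Differentiable ℂ G)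
    (hne : ∃ w, G w ≠ 0) (S : Finset ℝ) (hS : ∀ s ∈ S, 0 < s) :
    ∃ g : ℂ → ℂ, Differentiable ℂ g ∧ (∀ s ∈ S, g (-(s : ℂ)) ≠ 0) ∧
      ∀ w, G w = (∏ s ∈ S, (1 + w / s) ^ analyticOrderNatAt G (-(s : ℂ))) * g w := by
  classical
  induction S using Finset.induction_on with
  | empty => exact ⟨G, hG, by simp, by simp⟩
  | insert t S ht ih =>
    obtain ⟨g, hg, hgS, hgG⟩ := ih fun s hs => hS s (Finset.mem_insert_of_mem hs)
    have htpos : 0 < t := hS t (Finset.mem_insert_self t S)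
    have ht0 : (t : ℂ) ≠ 0 := by exact_mod_cast htpos.ne'
    have hgne : ∃ w, g w ≠ 0 := by
      obtain ⟨w, hw⟩ := hne
      exact ⟨w, fun h => hw (by rw [hgG, h, mul_zero])⟩
    obtain ⟨k, hk, hkt, hkg⟩ := hg.exists_eq_pow_mul (-(t : ℂ)) hgne
    have hprod : Differentiable ℂ
        fun w : ℂ => ∏ s ∈ S, (1 + w / s) ^ analyticOrderNatAt G (-(s : ℂ)) := by
      fun_prop
    have hord : analyticOrderNatAt G (-(t : ℂ)) = analyticOrderNatAt g (-(t : ℂ)) := by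
      conv_lhs => rw [funext hgG]
      refine analyticOrderNatAt_mul_of_ne_zero (hprod.analyticAt _) (hg.analyticAt _) ?_
      refine Finset.prod_ne_zero_iff.2 fun s hs => pow_ne_zero _ ?_
      refine one_add_div_ne_zero (hS s (Finset.mem_insert_of_mem hs)) fun h => ht ?_
      have : t = s := by exact_mod_cast neg_injective h
      exact this ▸ hs
    refine ⟨fun w => (t : ℂ) ^ analyticOrderNatAt G (-(t : ℂ)) * k w, hk.const_mul _, ?_, ?_⟩
    · intro s hs
      refine mul_ne_zero (pow_ne_zero _ ht0) ?_
      rcases Finset.mem_insert.1 hs with rfl | hs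
      · exact hkt
      · intro h
        apply hgS s hs
        rw [hkg, h, mul_zero]
    · intro w
      rw [Finset.prod_insert ht, hgG w, hkg w, ← hord]
      have : w - -(t : ℂ) = (1 + w / t) * t := by field_simp; ring
      rw [this, mul_pow]; ring

theorem exists_log_of_ne_zero_on_ball {g : ℂ → ℂ} (hg : Differentiable ℂ g) {R : ℝ} (hR : 0 < R)
    (h0 : g 0 = 1) (hne : ∀ w ∈ Metric.ball (0 : ℂ) R, g w ≠ 0) :
    ∃ h : ℂ → ℂ, h 0 = 0 ∧ (∀ w ∈ Metric.ball (0 : ℂ) R, HasDerivAt h (deriv g w / g w) w) ∧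
      ∀ w ∈ Metric.ball (0 : ℂ) R, Complex.exp (h w) = g w := by
  have hg' : Differentiable ℂ (deriv g) :=
    (hg.contDiff (n := 2)).differentiable_deriv_two
  have hd : DifferentiableOn ℂ (fun w => deriv g w / g w) (Metric.ball 0 R) :=
    hg'.differentiableOn.div hg.differentiableOn hne
  obtain ⟨h, hh0, hh⟩ := hd.isExactOn_ball.with_val_at 0 0
  refine ⟨h, hh0, hh, fun w hw => ?_⟩
  have hder : ∀ z ∈ Metric.ball (0 : ℂ) R, HasDerivAt (fun w => g w * Complex.exp (-h w)) 0 z := by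
    intro z hz
    have := (hg z).hasDerivAt.mul (hh z hz).neg.cexp
    refine this.congr_deriv ?_
    have := hne z hz
    simp only [Pi.neg_apply]
    field_simp
    ring
  have hconst := Metric.isOpen_ball.is_const_of_deriv_eq_zero
    (Metric.isPreconnected_ball (x := (0 : ℂ)) (r := R))
    (fun z hz => (hder z hz).differentiableAt.differentiableWithinAt)
    (fun z hz => (hder z hz).deriv) hw (Metric.mem_ball_self hR)
  simp only [hh0, h0, neg_zero, Complex.exp_zero, mul_one] at hconst
  rw [Complex.exp_neg] at hconst
  have he := Complex.exp_ne_zero (h w)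
  field_simp at hconst
  exact hconst.symm

/-- Borel–Carathéodory bounds |h| by 2A on the circle of radius R/2. Cauchy's estimates bound the
coefficients, and a geometric tail of ratio at most 1/2 costs another factor 2. -/
theorem norm_sub_taylor_le {h : ℂ → ℂ} {R A : ℝ} (hR : 0 < R) (hA : 0 < A)
    (hd : DifferentiableOn ℂ h (Metric.ball 0 R)) (h0 : h 0 = 0)
    (hre : ∀ w ∈ Metric.ball (0 : ℂ) R, (h w).re ≤ A) (K : ℕ) {w : ℂ} (hw : ‖w‖ ≤ R / 4) :
    ‖h w - ∑ k ∈ Finset.range K, iteratedDeriv k h 0 / k.factorial * w ^ k‖ ≤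
      4 * A * (2 * ‖w‖ / R) ^ K := by
  have hbc : ∀ z ∈ Metric.sphere (0 : ℂ) (R / 2), ‖h z‖ ≤ 2 * A := by
    intro z hz
    have hz' : ‖z‖ = R / 2 := by simpa using hz
    have := Complex.borelCaratheodory_zero hA hd hre hR (z := z)
      (by simp [hz']; linarith) h0
    rw [hz'] at this
    refine this.trans_eq ?_
    field_simp
    ring
  have hcoef : ∀ k : ℕ, ‖iteratedDeriv k h 0 / k.factorial * w ^ k‖ ≤ 2 * A * (2 * ‖w‖ / R) ^ k := by
    intro k
    have h1 := Complex.norm_iteratedDeriv_le_of_forall_mem_sphere_norm_le k (by positivity)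
      (DifferentiableOn.diffContOnCl (𝕜 := ℂ) (f := h) (s := Metric.ball 0 (R / 2)) (hd.mono
        ((Metric.closure_ball_subset_closedBall).trans
          (Metric.closedBall_subset_ball (by linarith))))) hbc
    rw [norm_mul, norm_div, Complex.norm_natCast, norm_pow]
    have h2 : ‖iteratedDeriv k h 0‖ / k.factorial ≤ 2 * A / (R / 2) ^ k := by
      rw [div_le_iff₀ (by positivity)]
      refine h1.trans_eq ?_
      ring
    calc _ ≤ 2 * A / (R / 2) ^ k * ‖w‖ ^ k := by gcongr
      _ = _ := by rw [div_pow, div_pow, mul_pow]; field_simp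
  have hx0 : 0 ≤ 2 * ‖w‖ / R := by positivity
  have hx1 : 2 * ‖w‖ / R ≤ 1 / 2 := by
    rw [div_le_iff₀ hR]; linarith
  have hsum := Complex.hasSum_taylorSeries_on_ball hd (z := w) (by simp; linarith)
  have hsum' : HasSum (fun k : ℕ => iteratedDeriv k h 0 / k.factorial * w ^ k) (h w) := by
    refine hsum.congr_fun ?_
    intro k
    simp [div_eq_inv_mul]; ring
  have htail := (hasSum_nat_add_iff' K).2 hsum'
  have hgeo : HasSum (fun k : ℕ => 2 * A * (2 * ‖w‖ / R) ^ K * (2 * ‖w‖ / R) ^ k)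
      (2 * A * (2 * ‖w‖ / R) ^ K * (1 - 2 * ‖w‖ / R)⁻¹) :=
    (hasSum_geometric_of_lt_one hx0 (by linarith)).mul_left _
  have hle := htail.norm_le_of_bounded hgeo fun k => by
    refine (hcoef (k + K)).trans_eq ?_
    rw [pow_add]; ring
  refine hle.trans ?_
  have h3 : (1 - 2 * ‖w‖ / R)⁻¹ ≤ 2 := by
    rw [inv_le_comm₀ (by linarith) (by norm_num)]; linarith
  calc _ ≤ 2 * A * (2 * ‖w‖ / R) ^ K * 2 := by gcongr
    _ = _ := by ring

theorem iteratedDeriv_inv_add {s : ℝ} (k : ℕ) :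
    iteratedDeriv k (fun w : ℂ => ((s : ℂ) + w)⁻¹) 0 = (-1) ^ k * k.factorial / (s : ℂ) ^ (k + 1) := by
  have h := congrFun (iter_deriv_inv_linear k (1 : ℂ) (s : ℂ)) 0
  rw [iteratedDeriv_eq_iterate]
  have h2 : (fun w : ℂ => ((s : ℂ) + w)⁻¹) = fun w => (1 * w + (s : ℂ))⁻¹ := by
    funext w; rw [one_mul, add_comm]
  rw [h2, h]
  have : (-1 - (k : ℤ)) = -((k + 1 : ℕ) : ℤ) := by push_cast; ring
  rw [this, zpow_neg, zpow_natCast]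
  simp
  rfl

/-- Taking logarithmic derivatives, h' = G'/G - ∑ ν(s)/(s + w) near 0; the coefficients are read off
from the geometric expansion of each fraction. -/
theorem iteratedDeriv_log_coeff {G g h : ℂ → ℂ} (hG0 : G 0 = 1) (hG : Differentiable ℂ G)
    (hg : Differentiable ℂ g) {S : Finset ℝ} (hS : ∀ s ∈ S, 0 < s) (ν : ℝ → ℕ)
    (hfac : ∀ w, G w = (∏ s ∈ S, (1 + w / s) ^ ν s) * g w) {R : ℝ} (hR : 0 < R)
    (hh : ∀ w ∈ Metric.ball (0 : ℂ) R, HasDerivAt h (deriv g w / g w) w) (k : ℕ) :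
    iteratedDeriv (k + 1) h 0 / (k + 1).factorial =
      iteratedDeriv k (fun w => deriv G w / G w) 0 / (k + 1).factorial +
        (-1) ^ (k + 1) / (k + 1 : ℕ) * ∑ s ∈ S, (ν s : ℂ) / (s : ℂ) ^ (k + 1) := by
  have hev : deriv h =ᶠ[𝓝 0] fun w => deriv G w / G w - ∑ s ∈ S, (ν s : ℂ) * ((s : ℂ) + w)⁻¹ := by
    have hGne : ∀ᶠ w in 𝓝 (0 : ℂ), G w ≠ 0 :=
      hG.continuous.continuousAt.eventually_ne (by simp [hG0])
    filter_upwards [hGne, Metric.ball_mem_nhds 0 hR] with w hw hwR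
    rw [(hh w hwR).deriv]
    have hgw : g w ≠ 0 := fun h => hw (by rw [hfac, h, mul_zero])
    have hpw : ∏ s ∈ S, (1 + w / (s : ℂ)) ^ ν s ≠ 0 := fun h => hw (by rw [hfac, h, zero_mul])
    have hlog : logDeriv G w = ∑ s ∈ S, (ν s : ℂ) * ((s : ℂ) + w)⁻¹ + logDeriv g w := by
      rw [show G = fun w => (∏ s ∈ S, (1 + w / (s : ℂ)) ^ ν s) * g w from funext hfac,
        logDeriv_mul w hpw hgw (by fun_prop) (hg w)]
      congr 1
      rw [logDeriv_prod (f := fun (s : ℝ) (w : ℂ) => (1 + w / (s : ℂ)) ^ ν s)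
        (fun s hs => Finset.prod_ne_zero_iff.1 hpw s hs) (fun s hs => by fun_prop)]
      refine Finset.sum_congr rfl fun s hs => ?_
      rw [logDeriv_fun_pow (by fun_prop), logDeriv_apply]
      have hs0 : (s : ℂ) ≠ 0 := by exact_mod_cast (hS s hs).ne'
      have : deriv (fun w : ℂ => 1 + w / (s : ℂ)) w = 1 / s := by simp
      rw [this]
      congr 1
      have : 1 + w / (s : ℂ) = ((s : ℂ) + w) / s := by field_simp
      rw [this]
      field_simp
    rw [logDeriv_apply, logDeriv_apply] at hlog
    rw [hlog]; ring
  have hGan : AnalyticAt ℂ (fun w => deriv G w / G w) 0 :=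
    ((hG.analyticAt 0).deriv).div (hG.analyticAt 0) (by simp [hG0])
  have hinv : ∀ s ∈ S, AnalyticAt ℂ (fun w : ℂ => ((s : ℂ) + w)⁻¹) 0 := fun s hs => by
    refine AnalyticAt.inv (by fun_prop) ?_
    simpa using (hS s hs).ne'
  rw [iteratedDeriv_succ', (hev.iteratedDeriv_eq k)]
  rw [iteratedDeriv_fun_sub hGan.contDiffAt (ContDiffAt.sum fun s hs =>
    contDiffAt_const.mul (hinv s hs).contDiffAt), iteratedDeriv_fun_sum fun s hs =>
    contDiffAt_const.mul (hinv s hs).contDiffAt]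
  have h1 : ∀ s ∈ S, iteratedDeriv k (fun w : ℂ => (ν s : ℂ) * ((s : ℂ) + w)⁻¹) 0 =
      (-1) ^ k * k.factorial * ((ν s : ℂ) / (s : ℂ) ^ (k + 1)) := fun s hs => by
    rw [iteratedDeriv_const_mul_field, iteratedDeriv_inv_add]; ring
  rw [Finset.sum_congr rfl h1, ← Finset.mul_sum, sub_div, sub_eq_add_neg]
  congr 1
  rw [Nat.factorial_succ]
  push_cast
  have : (k.factorial : ℂ) ≠ 0 := by exact_mod_cast k.factorial_ne_zero
  have : (k + 1 : ℂ) ≠ 0 := by exact_mod_cast k.succ_ne_zero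
  field_simp
  ring

theorem log_norm_one_add_div {s r θ : ℝ} :
    Real.log ‖1 + (r * Complex.exp (θ * Complex.I)) / (s : ℂ)‖ = primaryLog 0 θ (r / s) := by
  have h : ‖1 + (r * Complex.exp (θ * Complex.I)) / (s : ℂ)‖ ^ 2 =
      1 + 2 * (r / s) * Real.cos θ + (r / s) ^ 2 := by
    have e : 1 + (r * Complex.exp (θ * Complex.I)) / (s : ℂ) =
        ((1 + r / s * Real.cos θ : ℝ) : ℂ) + ((r / s * Real.sin θ : ℝ) : ℂ) * Complex.I := by
      rw [Complex.exp_mul_I]; push_cast; ring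
    rw [e, Complex.sq_norm, Complex.normSq_add_mul_I]
    linear_combination (r / s) ^ 2 * Real.sin_sq_add_cos_sq θ
  unfold primaryLog
  rw [← h, Real.log_pow]
  simp

theorem genusSum_eq_sum_genusCoeff (Z : Finset ℝ) (ν : ℝ → ℕ) (p : ℕ → ℝ) (N : ℕ) (r α : ℝ) :
    genusSum Z ν p N r α =
      ∑ k ∈ Finset.Icc 1 N, genusCoeff Z ν p k * (r ^ k * Real.cos (k * α)) +
        ∑ s ∈ Z, ν s * primaryLog 0 α (r / s) := by
  induction N with
  | zero => simp [genusSum]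
  | succ N ih => rw [genusSum_succ, ih, Finset.sum_Icc_succ_top (by omega)]; ring

theorem sum_range_succ_eq_sum_Icc {E : Type*} [AddCommMonoid E] (f : ℕ → E) (K : ℕ) :
    ∑ k ∈ Finset.range (K + 1), f k = f 0 + ∑ k ∈ Finset.Icc 1 K, f k := by
  induction K with
  | zero => simp
  | succ K ih => rw [Finset.sum_range_succ, ih, Finset.sum_Icc_succ_top (by omega), add_assoc]

/-- Infinitely many zeros in a bounded interval would accumulate, and the identity theorem would
make G vanish identically. -/
theorem finite_negative_zeros {G : ℂ → ℂ} (hG : Differentiable ℂ G) (hne : ∃ w, G w ≠ 0) (R : ℝ) :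
    {s : ℝ | 0 < s ∧ s < R ∧ G (-(s : ℂ)) = 0}.Finite := by
  by_contra hinf
  obtain ⟨x, -, hx⟩ := Set.Infinite.exists_accPt_of_subset_isCompact hinf
    (isCompact_Icc (a := (0 : ℝ)) (b := R)) fun s hs => ⟨hs.1.le, hs.2.1.le⟩
  obtain ⟨w, hw⟩ := hne
  have hH : Differentiable ℂ fun w => G (-w) := hG.comp differentiable_neg
  have hfreq : ∃ᶠ z in 𝓝[≠] (x : ℂ), G (-z) = 0 := by
    rw [accPt_iff_frequently_nhdsNE] at hx
    have ht : Tendsto (fun s : ℝ => (s : ℂ)) (𝓝[≠] x) (𝓝[≠] (x : ℂ)) :=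
      (Complex.continuous_ofReal.continuousAt.tendsto).inf
        (by simp)
    exact ht.frequently (hx.mono fun s hs => hs.2.2)
  have h0 := AnalyticOnNhd.eqOn_zero_of_preconnected_of_frequently_eq_zero
    (f := fun w => G (-w)) (U := Set.univ) (fun z _ => hH.analyticAt z) isPreconnected_univ
    (Set.mem_univ (x : ℂ)) hfreq
  have := h0 (Set.mem_univ (-w))
  simp at this
  exact hw this

/-! ### Hadamard representation of log‖G‖ -/

/-- The mean of `log ‖G‖` over the points of polar coordinates `(r, α)` and `(r, -α)`. -/
noncomputable def symmLogNorm (G : ℂ → ℂ) (r α : ℝ) : ℝ :=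
  (Real.log ‖G (r * Complex.exp (α * Complex.I))‖ +
    Real.log ‖G (r * Complex.exp ((-α : ℝ) * Complex.I))‖) / 2

/-- Symmetrizing in the angle cancels the sine terms, so only real parts of Taylor coefficients
survive. -/
theorem re_mul_polar_add (c : ℂ) (r α : ℝ) (k : ℕ) :
    (c * (r * Complex.exp (α * Complex.I)) ^ k).re +
      (c * (r * Complex.exp ((-α : ℝ) * Complex.I)) ^ k).re =
        2 * (c.re * (r ^ k * Real.cos (k * α))) := by
  have e : ∀ θ : ℝ, (c * (r * Complex.exp (θ * Complex.I)) ^ k).re =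
      c.re * (r ^ k * Real.cos (k * θ)) - c.im * (r ^ k * Real.sin (k * θ)) := by
    intro θ
    have : (r * Complex.exp (θ * Complex.I)) ^ k =
        ((r ^ k * Real.cos (k * θ) : ℝ) : ℂ) + ((r ^ k * Real.sin (k * θ) : ℝ) : ℂ) * Complex.I := by
      rw [mul_pow, ← Complex.exp_nat_mul,
        show (k : ℂ) * (θ * Complex.I) = ((k * θ : ℝ) : ℂ) * Complex.I by push_cast; ring,
        Complex.exp_mul_I]
      push_cast; ring
    rw [this]
    generalize r ^ k * Real.cos (k * θ) = x
    generalize r ^ k * Real.sin (k * θ) = y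
    simp
  rw [e, e]
  simp
  ring

/-- Divide out the zeros of modulus below R. The quotient has a logarithm on the disc of radius R
with real part at most A, and its Taylor polynomial of degree K supplies exactly the coefficients of
the genus-K sum. -/
theorem abs_symmLogNorm_sub_genusSum_le {G : ℂ → ℂ} (hG : Differentiable ℂ G) (h0 : G 0 = 1)
    (hz : ∀ w, G w = 0 → ∃ s : ℝ, 0 < s ∧ w = -(s : ℂ)) {R A : ℝ} (hR : 0 < R) (hA : 0 < A)
    (hgrow : ∀ w : ℂ, ‖w‖ = 2 * R → ‖G w‖ ≤ Real.exp A) {S : Finset ℝ}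
    (hS : ∀ s : ℝ, s ∈ S ↔ 0 < s ∧ s < R ∧ G (-(s : ℂ)) = 0) (K : ℕ) {r α : ℝ} (hr : 0 ≤ r)
    (hrR : r ≤ R / 4) (hα : -1 < Real.cos α) :
    |symmLogNorm G r α - genusSum S (fun s => analyticOrderNatAt G (-(s : ℂ)))
      (fun k => (iteratedDeriv (k - 1) (fun w => deriv G w / G w) 0 / k.factorial).re) K r α| ≤
      4 * A * (2 * r / R) ^ (K + 1) := by
  have hSpos : ∀ s ∈ S, 0 < s := fun s hs => ((hS s).1 hs).1
  obtain ⟨g, hg, hgS, hfac⟩ := hG.exists_eq_prod_mul ⟨0, by simp [h0]⟩ S hSpos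
  set ν : ℝ → ℕ := fun s => analyticOrderNatAt G (-(s : ℂ)) with hν
  have hfac' : ∀ w, G w = (∏ s ∈ S, (1 + w / s) ^ ν s) * g w := hfac
  have hg0 : g 0 = 1 := by
    have := hfac 0
    simpa [h0] using this.symm
  have hgne : ∀ w ∈ Metric.ball (0 : ℂ) R, g w ≠ 0 := by
    intro w hw h
    obtain ⟨s, hs, rfl⟩ := hz w (by rw [hfac, h, mul_zero])
    refine hgS s ((hS s).2 ⟨hs, ?_, by rw [hfac, h, mul_zero]⟩) h
    simpa [abs_of_pos hs] using hw
  have hgbound : ∀ w ∈ Metric.ball (0 : ℂ) (2 * R), ‖g w‖ ≤ Real.exp A := by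
    intro w hw
    refine Complex.norm_le_of_forall_mem_frontier_norm_le Metric.isBounded_ball
      hg.diffContOnCl (fun z hz => ?_) (subset_closure hw)
    have hz' : ‖z‖ = 2 * R := by
      have := Metric.frontier_ball_subset_sphere hz
      simpa using this
    refine le_trans ?_ (hgrow z hz')
    rw [hfac z, norm_mul, norm_prod]
    refine le_mul_of_one_le_left (norm_nonneg _) ?_
    refine Finset.one_le_prod fun s hs => ?_
    rw [norm_pow]
    refine one_le_pow₀ ?_
    obtain ⟨hs0, hsR, -⟩ := (hS s).1 hs
    -- On the circle of radius 2R each removed factor has modulus at least 1, so dividing by it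
    -- preserves the bound.
    have h1 : 2 ≤ ‖z / (s : ℂ)‖ := by
      rw [norm_div, Complex.norm_real, Real.norm_of_nonneg hs0.le, hz', le_div_iff₀ hs0]
      linarith
    have h2 := norm_sub_le (1 + z / (s : ℂ)) 1
    simp only [add_sub_cancel_left, norm_one] at h2
    linarith
  obtain ⟨h, hh0, hhd, hhe⟩ := exists_log_of_ne_zero_on_ball hg hR hg0 hgne
  have hre : ∀ w ∈ Metric.ball (0 : ℂ) R, (h w).re ≤ A := by
    intro w hw
    have := hgbound w (Metric.ball_subset_ball (by linarith) hw)
    rwa [← hhe w hw, Complex.norm_exp, Real.exp_le_exp] at this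
  have htay := fun w hw => norm_sub_taylor_le hR hA
    (fun w hw => (hhd w hw).differentiableAt.differentiableWithinAt) hh0 hre (K + 1) (w := w) hw
  have hnorm : ∀ θ : ℝ, ‖(r : ℂ) * Complex.exp (θ * Complex.I)‖ = r := by
    intro θ; simp [Complex.norm_exp_ofReal_mul_I, abs_of_nonneg hr]
  have hlog : ∀ θ : ℝ, -1 < Real.cos θ → Real.log ‖G (r * Complex.exp (θ * Complex.I))‖ =
      (h (r * Complex.exp (θ * Complex.I))).re + ∑ s ∈ S, ν s * primaryLog 0 θ (r / s) := by
    intro θ hθ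
    have hmem : (r : ℂ) * Complex.exp (θ * Complex.I) ∈ Metric.ball (0 : ℂ) R := by
      rw [mem_ball_zero_iff, hnorm]; linarith
    have hne : ∀ s ∈ S, ‖1 + (r * Complex.exp (θ * Complex.I)) / (s : ℂ)‖ ≠ 0 := by
      intro s hs h
      rw [norm_eq_zero] at h
      refine one_add_div_ne_zero (hSpos s hs) ?_ h
      intro h2
      have hre := congrArg Complex.re h2
      have him := congrArg Complex.im h2
      have hsp := hSpos s hs
      rw [Complex.exp_mul_I] at hre him
      simp [Complex.cos_ofReal_re, Complex.sin_ofReal_re, Complex.cos_ofReal_im,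
        Complex.sin_ofReal_im] at hre him
      have hr0 : 0 < r := by
        rcases hr.eq_or_lt with h | h
        · rw [← h] at hre; simp at hre; linarith
        · exact h
      have hs0 : Real.sin θ = 0 := him.resolve_left hr0.ne'
      have := Real.sin_sq_add_cos_sq θ
      rw [hs0] at this
      nlinarith
    rw [hfac', norm_mul, ← hhe _ hmem, Complex.norm_exp, norm_prod, Real.log_mul
      (Finset.prod_ne_zero_iff.2 fun s hs => by rw [norm_pow]; exact pow_ne_zero _ (hne s hs))
      (Real.exp_ne_zero _), Real.log_exp, Real.log_prod
      fun s hs => by rw [norm_pow]; exact pow_ne_zero _ (hne s hs), add_comm]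
    congr 1
    refine Finset.sum_congr rfl fun s hs => ?_
    rw [norm_pow, Real.log_pow, log_norm_one_add_div]
  -- The truncated `k - 1` is harmless: only indices k ≥ 1 enter the sums.
  set p : ℕ → ℝ :=
    fun k => (iteratedDeriv (k - 1) (fun w => deriv G w / G w) 0 / k.factorial).re with hp
  have hcoef : ∀ k ∈ Finset.Icc 1 K,
      genusCoeff S ν p k = (iteratedDeriv k h 0 / k.factorial).re := by
    intro k hk
    obtain ⟨j, rfl⟩ := Nat.exists_eq_add_of_le' (Finset.mem_Icc.1 hk).1
    rw [iteratedDeriv_log_coeff h0 hG hg hSpos ν hfac' hR hhd j, Complex.add_re]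
    unfold genusCoeff
    rw [hp]
    simp only [Nat.add_sub_cancel]
    congr 1
    rw [← Complex.ofReal_re ((-1) ^ (j + 1) / (j + 1 : ℕ) * ∑ s ∈ S, (ν s : ℝ) / s ^ (j + 1))]
    congr 1
    push_cast
    rfl
  set w₁ : ℂ := r * Complex.exp (α * Complex.I)
  set w₂ : ℂ := r * Complex.exp ((-α : ℝ) * Complex.I)
  have hw₁ : ‖w₁‖ = r := hnorm α
  have hw₂ : ‖w₂‖ = r := hnorm (-α)
  set T : ℂ → ℂ := fun w => ∑ k ∈ Finset.range (K + 1), iteratedDeriv k h 0 / k.factorial * w ^ k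
  have hT : (T w₁).re + (T w₂).re =
      2 * ∑ k ∈ Finset.Icc 1 K, genusCoeff S ν p k * (r ^ k * Real.cos (k * α)) := by
    simp only [T]
    rw [sum_range_succ_eq_sum_Icc, sum_range_succ_eq_sum_Icc]
    simp only [iteratedDeriv_zero, hh0, zero_div, zero_mul, zero_add, Complex.re_sum]
    rw [← Finset.sum_add_distrib, Finset.mul_sum]
    refine Finset.sum_congr rfl fun k hk => ?_
    rw [re_mul_polar_add, hcoef k hk]
  have hcosneg : -1 < Real.cos (-α) := by rwa [Real.cos_neg]
  have hpl : ∀ x, primaryLog 0 (-α) x = primaryLog 0 α x := by simp [primaryLog]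
  have hmain : symmLogNorm G r α - genusSum S ν p K r α =
      ((h w₁ - T w₁).re + (h w₂ - T w₂).re) / 2 := by
    rw [genusSum_eq_sum_genusCoeff, symmLogNorm, hlog α hα, hlog (-α) hcosneg]
    simp only [hpl, Complex.sub_re]
    linarith
  rw [hmain]
  have b₁ := (Complex.abs_re_le_norm _).trans (htay w₁ (by rw [hw₁]; exact hrR))
  have b₂ := (Complex.abs_re_le_norm _).trans (htay w₂ (by rw [hw₂]; exact hrR))
  rw [hw₁] at b₁
  rw [hw₂] at b₂
  rw [abs_le] at b₁ b₂ ⊢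
  constructor <;> linarith [b₁.1, b₁.2, b₂.1, b₂.2]

/-! ### From the ridge property to exponential type -/

/-- An entire function of finite order with negative zeros whose modulus satisfies the ridge
property is of exponential type on the positive axis. -/
theorem norm_le_exp_of_ridge {G : ℂ → ℂ} (hG : Differentiable ℂ G) (h0 : G 0 = 1)
    (hz : ∀ w, G w = 0 → ∃ s : ℝ, 0 < s ∧ w = -(s : ℂ)) {C : ℝ} {N : ℕ}
    (hgrow : ∀ w, ‖G w‖ ≤ Real.exp (C * (1 + ‖w‖) ^ N))
    (hpos : ∀ r : ℝ, 0 ≤ r → 1 ≤ ‖G r‖)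
    (hridge : ∀ r β : ℝ, 0 ≤ r →
      ‖G (r * Complex.exp ((2 * β : ℝ) * Complex.I))‖ ≤ ‖G ((r * Real.cos β ^ 2 : ℝ) : ℂ)‖) :
    ∃ A : ℝ, ∀ r : ℝ, 0 ≤ r → ‖G r‖ ≤ Real.exp (A * r) := by
  have hne : ∃ w, G w ≠ 0 := ⟨0, by simp [h0]⟩
  set Z : ℕ → Finset ℝ := fun n => (finite_negative_zeros hG hne n).toFinset with hZdef
  have hmemZ : ∀ (n : ℕ) (s : ℝ), s ∈ Z n ↔ 0 < s ∧ s < n ∧ G (-(s : ℂ)) = 0 := by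
    intro n s; simp [hZdef]
  have hZmono : Monotone Z := by
    intro a b hab s hs
    rw [hmemZ] at hs ⊢
    exact ⟨hs.1, hs.2.1.trans_le (by exact_mod_cast hab), hs.2.2⟩
  have hZpos : ∀ n, ∀ s ∈ Z n, 0 < s := fun n s hs => ((hmemZ n s).1 hs).1
  have hU : ∀ r : ℝ, symmLogNorm G r 0 = Real.log ‖G r‖ := by
    intro r; simp [symmLogNorm]
  have hU0 : ∀ r, 0 ≤ r → 0 ≤ symmLogNorm G r 0 := fun r hr => by
    rw [hU]; exact Real.log_nonneg (hpos r hr)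
  have hlogle : ∀ r β : ℝ, 0 ≤ r → Real.log ‖G (r * Complex.exp ((2 * β : ℝ) * Complex.I))‖ ≤
      Real.log ‖G ((r * Real.cos β ^ 2 : ℝ) : ℂ)‖ := by
    intro r β hr
    have h1 := hpos (r * Real.cos β ^ 2) (by positivity)
    rcases (norm_nonneg (G (r * Complex.exp ((2 * β : ℝ) * Complex.I)))).eq_or_lt with h | h
    -- At a zero of G the convention log 0 = 0 still gives the inequality, because ‖G‖ ≥ 1 on the
    -- positive axis.
    · rw [← h, Real.log_zero]; exact Real.log_nonneg h1
    · exact Real.log_le_log h (hridge r β hr)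
  have hUr : ∀ r β, 0 ≤ r → 0 < β → β < Real.pi / 2 →
      symmLogNorm G r (2 * β) ≤ symmLogNorm G (r * Real.cos β ^ 2) 0 := by
    intro r β hr _ _
    rw [hU, symmLogNorm]
    have h1 := hlogle r β hr
    have h2 := hlogle r (-β) hr
    rw [Real.cos_neg, mul_neg] at h2
    linarith
  have hrep : ∀ r α, 0 ≤ r → 0 ≤ α → α < Real.pi → Tendsto (fun n =>
      genusSum (Z n) (fun s => analyticOrderNatAt G (-(s : ℂ)))
        (fun k => (iteratedDeriv (k - 1) (fun w => deriv G w / G w) 0 / k.factorial).re)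
        (N + 1) r α) atTop (𝓝 (symmLogNorm G r α)) := by
    intro r α hr hα0 hα1
    have hα : -1 < Real.cos α := by
      rw [← Real.cos_pi]
      exact Real.cos_lt_cos_of_nonneg_of_le_pi hα0 le_rfl hα1
    have hlim : Tendsto (fun n : ℕ => 4 * (|C| + 1) * 3 ^ N * (2 * r) ^ (N + 2) *
        ((1 / (n : ℝ)) * (1 / (n : ℝ)))) atTop (𝓝 0) := by
      have := tendsto_one_div_atTop_nhds_zero_nat (𝕜 := ℝ)
      simpa using (this.mul this).const_mul (4 * (|C| + 1) * 3 ^ N * (2 * r) ^ (N + 2))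
    rw [tendsto_iff_dist_tendsto_zero]
    refine squeeze_zero' (Eventually.of_forall fun _ => dist_nonneg) ?_ hlim
    filter_upwards [eventually_ge_atTop 1, eventually_ge_atTop ⌈4 * r⌉₊] with n hn1 hn2
    have hn1' : (1 : ℝ) ≤ n := by exact_mod_cast hn1
    have hn0 : (0 : ℝ) < n := by linarith
    have hn2' : 4 * r ≤ n := Nat.ceil_le.1 hn2
    rw [dist_comm, Real.dist_eq]
    -- With R = n the growth constant is O(n^N), while degree N + 1 gives a factor O(n^{-(N+2)}), so
    -- the error is O(n^{-2}).
    refine (abs_symmLogNorm_sub_genusSum_le hG h0 hz hn0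
      (A := (|C| + 1) * (3 * n) ^ N) (by positivity) (fun w hw => ?_) (hmemZ n) (N + 1) hr
      (by linarith) hα).trans_eq ?_
    · refine (hgrow w).trans (Real.exp_le_exp.2 ?_)
      rw [hw]
      have : 1 + 2 * (n : ℝ) ≤ 3 * n := by linarith
      have hC : C ≤ |C| + 1 := by linarith [le_abs_self C]
      gcongr
    · rw [mul_pow, div_pow]
      field_simp
      ring
  refine ⟨_, fun r hr => (Real.log_le_iff_le_exp (by linarith [hpos r hr])).1 ((hU r).symm.trans_le
    (genusSum_descent hZmono hZpos hU0 hUr hrep hr))⟩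

/-! ### Even functions and exponential moments -/

theorem exists_comp_sq_eq_of_even {F : ℂ → ℂ} (hF : Differentiable ℂ F) (heven : ∀ z, F (-z) = F z) :
    ∃ G : ℂ → ℂ, Differentiable ℂ G ∧ ∀ z, G (z ^ 2) = F z := by
  have hsq : ∀ z z' : ℂ, z ^ 2 = z' ^ 2 → F z = F z' := by
    intro z z' h
    rcases sq_eq_sq_iff_eq_or_eq_neg.1 h with rfl | rfl
    · rfl
    · exact heven z'
  have hroot : ∀ w : ℂ, (w ^ (1 / 2 : ℂ)) ^ 2 = w := by
    intro w
    simp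
  refine ⟨fun w => F (w ^ (1 / 2 : ℂ)), ?_, fun z => hsq _ _ (hroot _)⟩
  have hne : ∀ w : ℂ, w ≠ 0 → DifferentiableAt ℂ (fun w => F (w ^ (1 / 2 : ℂ))) w := by
    intro w hw
    by_cases hs : w ∈ Complex.slitPlane
    · exact (hF _).comp w (differentiableAt_id.cpow_const hs)
    · have hs' : -w ∈ Complex.slitPlane := by
        rw [Complex.mem_slitPlane_iff] at hs ⊢
        push Not at hs
        left
        have : w.re ≠ 0 := fun h => hw (Complex.ext h hs.2)
        have := lt_of_le_of_ne hs.1 this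
        simpa using this
      -- On the cut, evenness lets the root be replaced by i(-w)^{1/2}, which is holomorphic there.
      -- At 0 the singularity is removable by continuity.
      have heq : (fun w => F (w ^ (1 / 2 : ℂ))) =
          fun w => F (Complex.I * (-w) ^ (1 / 2 : ℂ)) := by
        funext v
        apply hsq
        rw [mul_pow, hroot, hroot, Complex.I_sq]; ring
      rw [heq]
      exact (hF _).comp w ((differentiableAt_id.neg.cpow_const hs').const_mul _)
  intro w
  by_cases hw : w = 0
  · subst hw
    refine (Complex.analyticAt_of_differentiable_on_punctured_nhds_of_continuousAt ?_ ?_).differentiableAt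
    · filter_upwards [self_mem_nhdsWithin] with v hv using hne v hv
    · exact ContinuousAt.comp (g := F) hF.continuous.continuousAt
        (Complex.continuousAt_cpow_const_of_re_pos (by simp) (by norm_num))
  · exact hne w hw

/-- Split at |x|^{a-1} = t/b: beyond it t|x| ≤ b|x|^a, and below it |x| is bounded by a power of t.
-/
theorem exp_mul_abs_le {b a t x : ℝ} (hb : 0 < b) (ha : 1 < a) (ht : 0 ≤ t) :
    Real.exp (t * |x|) ≤ Real.exp (b * |x| ^ a) + Real.exp (t * (t / b) ^ (1 / (a - 1))) := by
  have ha' : 0 < a - 1 := by linarith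
  rcases le_total t (b * |x| ^ (a - 1)) with h | h
  · have h1 : t * |x| ≤ b * |x| ^ a := by
      rcases (abs_nonneg x).eq_or_lt with hx | hx
      · rw [← hx, Real.zero_rpow (by linarith)]; simp
      · calc t * |x| ≤ b * |x| ^ (a - 1) * |x| := by gcongr
          _ = b * (|x| ^ (a - 1) * |x| ^ (1 : ℝ)) := by rw [Real.rpow_one]; ring
          _ = b * |x| ^ a := by rw [← Real.rpow_add hx]; congr 2; ring
    have := Real.exp_le_exp.2 h1
    have := Real.exp_pos (t * (t / b) ^ (1 / (a - 1)))
    linarith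
  · have h1 : |x| ≤ (t / b) ^ (1 / (a - 1)) := by
      have h2 : |x| ^ (a - 1) ≤ t / b := by rw [le_div_iff₀ hb]; linarith
      calc |x| = (|x| ^ (a - 1)) ^ (1 / (a - 1)) := by
            rw [← Real.rpow_mul (abs_nonneg x), mul_one_div_cancel ha'.ne', Real.rpow_one]
        _ ≤ _ := by gcongr
    have := Real.exp_le_exp.2 (mul_le_mul_of_nonneg_left h1 ht)
    have := Real.exp_pos (b * |x| ^ a)
    linarith

section Probability

variable {Ω : Type*} [MeasurableSpace Ω] {P : Measure Ω} {X : Ω → ℝ}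

theorem integrable_exp_mul_rpow (hX : AEMeasurable X P) {a b : ℝ}
    (h : ∫⁻ ω, ENNReal.ofReal (Real.exp (b * |X ω| ^ a)) ∂P < ⊤) :
    Integrable (fun ω => Real.exp (b * |X ω| ^ a)) P := by
  have hm : AEMeasurable (fun ω => Real.exp (b * |X ω| ^ a)) P := by fun_prop
  refine ⟨hm.aestronglyMeasurable, ?_⟩
  rw [hasFiniteIntegral_iff_ofReal (Eventually.of_forall fun ω => (Real.exp_pos _).le)]
  exact h

theorem integrable_exp_mul_abs_of_rpow [IsProbabilityMeasure P] (hX : AEMeasurable X P) {a b : ℝ}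
    (hb : 0 < b) (ha : 1 < a)
    (h : Integrable (fun ω => Real.exp (b * |X ω| ^ a)) P) {t : ℝ} (ht : 0 ≤ t) :
    Integrable (fun ω => Real.exp (t * |X ω|)) P := by
  have hm : AEMeasurable (fun ω => Real.exp (t * |X ω|)) P := by fun_prop
  refine (h.add (integrable_const (Real.exp (t * (t / b) ^ (1 / (a - 1)))))).mono'
    hm.aestronglyMeasurable (Eventually.of_forall fun ω => ?_)
  rw [Real.norm_of_nonneg (Real.exp_pos _).le]
  exact exp_mul_abs_le hb ha ht

theorem integral_exp_mul_abs_le [IsProbabilityMeasure P] (hX : AEMeasurable X P) {a b : ℝ}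
    (hb : 0 < b) (ha : 1 < a) (h : Integrable (fun ω => Real.exp (b * |X ω| ^ a)) P) :
    ∃ (C : ℝ) (N : ℕ), 0 ≤ C ∧ ∀ t, 0 ≤ t →
      ∫ ω, Real.exp (t * |X ω|) ∂P ≤ Real.exp (C * (1 + t) ^ N) := by
  have ha' : 0 < a - 1 := by linarith
  set γ := 1 / (a - 1) with hγ
  have hγ0 : 0 ≤ γ := by positivity
  set J := ∫ ω, Real.exp (b * |X ω| ^ a) ∂P
  have hJ : 0 ≤ J := integral_nonneg fun ω => (Real.exp_pos _).le
  refine ⟨J + (1 / b) ^ γ, ⌈γ⌉₊ + 1, by positivity, fun t ht => ?_⟩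
  have h1 : ∫ ω, Real.exp (t * |X ω|) ∂P ≤ J + Real.exp (t * (t / b) ^ γ) := by
    have := integral_mono (integrable_exp_mul_abs_of_rpow hX hb ha h ht)
      (h.add (integrable_const (Real.exp (t * (t / b) ^ γ)))) fun ω =>
        exp_mul_abs_le (x := X ω) hb ha ht
    refine this.trans_eq ?_
    rw [integral_add' h (integrable_const _)]
    simp [J]
  have h2 : t * (t / b) ^ γ ≤ (1 / b) ^ γ * (1 + t) ^ (⌈γ⌉₊ + 1) := by
    have e : (t / b) ^ γ = (1 / b) ^ γ * t ^ γ := by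
      rw [← Real.mul_rpow (by positivity) ht]; congr 1; ring
    have h3 : t ^ γ ≤ (1 + t) ^ ⌈γ⌉₊ := by
      calc t ^ γ ≤ (1 + t) ^ γ := by gcongr; linarith
        _ ≤ (1 + t) ^ ((⌈γ⌉₊ : ℕ) : ℝ) :=
          Real.rpow_le_rpow_of_exponent_le (by linarith) (Nat.le_ceil γ)
        _ = _ := Real.rpow_natCast _ _
    calc t * (t / b) ^ γ = (1 / b) ^ γ * (t ^ γ * t) := by rw [e]; ring
      _ ≤ (1 / b) ^ γ * ((1 + t) ^ ⌈γ⌉₊ * (1 + t)) := by gcongr; linarith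
      _ = _ := by rw [pow_succ]
  have h4 : 1 ≤ (1 + t) ^ (⌈γ⌉₊ + 1) := one_le_pow₀ (by linarith)
  have h5 : 0 ≤ t * (t / b) ^ γ := by positivity
  calc _ ≤ J + Real.exp (t * (t / b) ^ γ) := h1
    _ ≤ Real.exp J * Real.exp (t * (t / b) ^ γ) := by
      have e1 := Real.add_one_le_exp J
      have e2 := Real.one_le_exp h5
      nlinarith
    _ = Real.exp (J + t * (t / b) ^ γ) := (Real.exp_add _ _).symm
    _ ≤ _ := by
      rw [Real.exp_le_exp, add_mul]
      nlinarith

/-- Jensen's inequality, by integrating the tangent line of exp at t · E X. -/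
theorem exp_mul_integral_le_mgf [IsProbabilityMeasure P] (hX : Integrable X P) {t : ℝ}
    (ht : Integrable (fun ω => Real.exp (t * X ω)) P) :
    Real.exp (t * ∫ ω, X ω ∂P) ≤ mgf X P t := by
  set m := ∫ ω, X ω ∂P with hm
  have hsub : Integrable (fun ω => t * (X ω - m)) P := (hX.sub (integrable_const m)).const_mul t
  have hint : Integrable (fun ω => Real.exp (t * m) * (1 + t * (X ω - m))) P :=
    ((integrable_const _).add hsub).const_mul _
  have h := integral_mono hint ht fun ω => by
    have h1 := Real.add_one_le_exp (t * (X ω - m))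
    calc Real.exp (t * m) * (1 + t * (X ω - m)) ≤ Real.exp (t * m) * Real.exp (t * (X ω - m)) := by
          gcongr; linarith
      _ = Real.exp (t * X ω) := by rw [← Real.exp_add]; ring_nf
  refine le_trans (le_of_eq ?_) h
  rw [integral_const_mul, integral_add (integrable_const _) hsub, integral_const_mul,
    integral_sub hX (integrable_const m)]
  simp [← hm]

theorem lintegral_exp_sub_sq (y : ℝ) :
    ∫⁻ t : ℝ, ENNReal.ofReal (Real.exp (-t ^ 2 + 2 * y * t)) =
      ENNReal.ofReal (Real.exp (y ^ 2)) * ENNReal.ofReal (Real.sqrt Real.pi) := by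
  have h1 : ∀ t : ℝ, ENNReal.ofReal (Real.exp (-t ^ 2 + 2 * y * t)) =
      ENNReal.ofReal (Real.exp (y ^ 2)) * ENNReal.ofReal (Real.exp (-1 * (t - y) ^ 2)) := by
    intro t
    rw [← ENNReal.ofReal_mul (Real.exp_pos _).le, ← Real.exp_add]
    congr 2; ring
  simp_rw [h1]
  rw [lintegral_const_mul _ (by fun_prop),
    lintegral_sub_right_eq_self (fun t : ℝ => ENNReal.ofReal (Real.exp (-1 * t ^ 2))) y,
    ← ofReal_integral_eq_lintegral_ofReal (integrable_exp_neg_mul_sq one_pos)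
      (Eventually.of_forall fun t => (Real.exp_pos _).le), integral_gaussian]
  simp

theorem lintegral_exp_neg_sq_add_lt_top (c : ℝ) :
    ∫⁻ t : ℝ, ENNReal.ofReal (Real.exp (-(1 / 2) * t ^ 2 + c * t)) < ⊤ := by
  have h : Integrable fun t : ℝ => Real.exp (-(1 / 2) * t ^ 2 + c * t) := by
    have h1 := ((integrable_exp_neg_mul_sq (b := 1 / 2) (by norm_num)).comp_sub_right c).const_mul
      (Real.exp (c ^ 2 / 2))
    refine h1.congr (Eventually.of_forall fun t => ?_)
    simp only
    rw [← Real.exp_add]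
    congr 1; ring
  exact (hasFiniteIntegral_iff_ofReal (Eventually.of_forall fun t => (Real.exp_pos _).le)).1 h.2

/-- Gaussian linearization: √π e^{bX²} = ∫ e^{-t² + 2√b X t} dt, and Tonelli reduces the claim to
the bound on the moment generating function. The choice of b gives 4Ab ≤ 1/2, leaving the weight
e^{-t²/2}. -/
theorem exists_lintegral_exp_mul_sq_lt_top [IsProbabilityMeasure P] (hX : AEMeasurable X P)
    (hint : ∀ t : ℝ, Integrable (fun ω => Real.exp (t * X ω)) P) {A m : ℝ}
    (h : ∀ t, mgf X P t ≤ Real.exp (A * t ^ 2 + m * t)) :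
    ∃ b : ℝ, 0 < b ∧ ∫⁻ ω, ENNReal.ofReal (Real.exp (b * X ω ^ 2)) ∂P < ⊤ := by
  set b := 1 / (8 * (|A| + 1)) with hb
  have hb0 : 0 < b := by positivity
  have hAb : 4 * A * b ≤ 1 / 2 := by
    rw [hb, mul_one_div, div_le_iff₀ (by positivity)]
    linarith [le_abs_self A]
  refine ⟨b, hb0, ?_⟩
  have hsq := Real.sq_sqrt hb0.le
  set q := Real.sqrt b
  have hXfst : AEMeasurable (fun z : Ω × ℝ => X z.1) (P.prod volume) :=
    hX.comp_quasiMeasurePreserving Measure.quasiMeasurePreserving_fst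
  have hswap := lintegral_lintegral_swap (μ := P) (ν := (volume : Measure ℝ))
    (f := fun ω t => ENNReal.ofReal (Real.exp (-t ^ 2 + 2 * (q * X ω) * t))) (by
      unfold Function.uncurry
      fun_prop)
  simp_rw [lintegral_exp_sub_sq, mul_pow, hsq] at hswap
  rw [lintegral_mul_const'' _ (by fun_prop)] at hswap
  have hfin : ∫⁻ t : ℝ, ∫⁻ ω, ENNReal.ofReal (Real.exp (-t ^ 2 + 2 * (q * X ω) * t)) ∂P < ⊤ := by
    refine lt_of_le_of_lt (lintegral_mono fun t => ?_)
      (lintegral_exp_neg_sq_add_lt_top (2 * q * m))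
    have e : ∀ ω, ENNReal.ofReal (Real.exp (-t ^ 2 + 2 * (q * X ω) * t)) =
        ENNReal.ofReal (Real.exp (-t ^ 2)) * ENNReal.ofReal (Real.exp (2 * q * t * X ω)) := by
      intro ω
      rw [← ENNReal.ofReal_mul (Real.exp_pos _).le, ← Real.exp_add]
      congr 2; ring
    simp_rw [e]
    rw [lintegral_const_mul'' _ (by fun_prop), ← ofReal_integral_eq_lintegral_ofReal (hint _)
      (Eventually.of_forall fun t => (Real.exp_pos _).le), ← ENNReal.ofReal_mul (Real.exp_pos _).le]
    refine ENNReal.ofReal_le_ofReal ?_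
    calc _ ≤ Real.exp (-t ^ 2) * Real.exp (A * (2 * q * t) ^ 2 + m * (2 * q * t)) := by
          gcongr; exact h _
      _ = Real.exp (-t ^ 2 + (A * (2 * q * t) ^ 2 + m * (2 * q * t))) := (Real.exp_add _ _).symm
      _ ≤ _ := by
        rw [Real.exp_le_exp]
        have : A * (2 * q * t) ^ 2 = 4 * A * b * t ^ 2 := by rw [← hsq]; ring
        rw [this]
        nlinarith [sq_nonneg t]
  rw [← hswap] at hfin
  refine ENNReal.lt_top_of_mul_ne_top_left hfin.ne ?_
  simp [Real.pi_pos]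

end Probability

/-! ### The main theorem -/

theorem mainTheorem2 {Ω : Type*} [MeasurableSpace Ω] (P : Measure Ω) [IsProbabilityMeasure P]
    (X : Ω → ℝ) (hX : AEMeasurable X P)
    (h₁ : ∃ b : ℝ, 0 < b ∧ ∃ a : ℝ, 1 < a ∧
      ∫⁻ ω, ENNReal.ofReal (Real.exp (b * |X ω| ^ a)) ∂P < ⊤)
    (h₂ : ∀ b' : ℝ, 0 < b' →
      ∫⁻ ω, ENNReal.ofReal (Real.exp (b' * X ω ^ 2)) ∂P = ⊤) :
    (∀ z : ℂ, Integrable (fun ω => Complex.exp (z * (X ω : ℂ))) P) ∧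
      ∃ z : ℂ, z.re ≠ 0 ∧ ∫ ω, Complex.exp (z * (X ω : ℂ)) ∂P = 0 := by
  obtain ⟨b, hb, a, ha, hab⟩ := h₁
  have hJ := integrable_exp_mul_rpow hX hab
  have habs : ∀ t : ℝ, 0 ≤ t → Integrable (fun ω => Real.exp (t * |X ω|)) P :=
    fun t ht => integrable_exp_mul_abs_of_rpow hX hb ha hJ ht
  have hle : ∀ t x : ℝ, Real.exp (t * x) ≤ Real.exp (|t| * |x|) := fun t x => by
    rw [Real.exp_le_exp, ← abs_mul]; exact le_abs_self _
  have hint : ∀ t : ℝ, Integrable (fun ω => Real.exp (t * X ω)) P := by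
    intro t
    have hm : AEMeasurable (fun ω => Real.exp (t * X ω)) P := by fun_prop
    refine (habs |t| (abs_nonneg t)).mono' hm.aestronglyMeasurable (Eventually.of_forall fun ω => ?_)
    rw [Real.norm_of_nonneg (Real.exp_pos _).le]
    exact hle t (X ω)
  have hset : integrableExpSet X P = Set.univ := Set.eq_univ_of_forall hint
  refine ⟨fun z => ?_, ?_⟩
  · have hm : AEMeasurable (fun ω => Complex.exp (z * (X ω : ℂ))) P := by fun_prop
    refine (hint z.re).mono' hm.aestronglyMeasurable (Eventually.of_forall fun ω => ?_)
    rw [Complex.norm_exp]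
    simp
  by_contra! hzero
  have hf0 : ∀ z : ℂ, complexMGF X P z = 0 → z.re = 0 := by
    intro z hz
    by_contra h
    exact hzero z h hz
  have hf1 : complexMGF X P 0 = 1 := by simp [complexMGF]
  have hf : Differentiable ℂ (complexMGF X P) := by
    intro z
    exact (hasDerivAt_complexMGF (by rw [hset, interior_univ]; trivial)).differentiableAt
  obtain ⟨C, N, hC, hgrow⟩ := integral_exp_mul_abs_le hX hb ha hJ
  have hmgf : ∀ t : ℝ, mgf X P t ≤ Real.exp (C * (1 + |t|) ^ N) := fun t =>
    (integral_mono (hint t) (habs |t| (abs_nonneg t)) fun ω => hle t (X ω)).trans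
      (hgrow |t| (abs_nonneg t))
  have hXint : Integrable X P := by
    have h := integrable_pow_of_integrable_exp_mul one_ne_zero (hint 1) (hint (-1)) 1
    simpa using h
  set m := ∫ ω, X ω ∂P
  have hjensen : ∀ t, Real.exp (t * m) ≤ mgf X P t := fun t => exp_mul_integral_le_mgf hXint (hint t)
  obtain ⟨G, hG, hGF⟩ := exists_comp_sq_eq_of_even
    (F := fun z => complexMGF X P z * complexMGF X P (-z)) (hf.mul (hf.comp differentiable_neg))
    fun z => by rw [neg_neg, mul_comm]
  have hGreal : ∀ x : ℝ, ‖G ((x ^ 2 : ℝ) : ℂ)‖ = mgf X P x * mgf X P (-x) := by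
    intro x
    rw [Complex.ofReal_pow, hGF, ← Complex.ofReal_neg, complexMGF_ofReal, complexMGF_ofReal,
      norm_mul, Complex.norm_real, Complex.norm_real, Real.norm_of_nonneg mgf_nonneg,
      Real.norm_of_nonneg mgf_nonneg]
  have hGnorm : ∀ z : ℂ, ‖G (z ^ 2)‖ ≤ mgf X P z.re * mgf X P (-z.re) := by
    intro z
    rw [hGF, norm_mul]
    have h1 := norm_complexMGF_le_mgf (X := X) (μ := P) (z := z)
    have h2 := norm_complexMGF_le_mgf (X := X) (μ := P) (z := -z)
    rw [Complex.neg_re] at h2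
    have := mgf_nonneg (X := X) (μ := P) (t := z.re)
    gcongr
  have hsqrt : ∀ w : ℂ, ∃ z : ℂ, z ^ 2 = w := fun w => IsAlgClosed.exists_pow_nat_eq w two_pos
  -- The product f(z)f(-z) doubles C, and 1 + |Re z| ≤ 2(1 + |z²|) produces the factor 2^N.
  have hmain := norm_le_exp_of_ridge hG (C := 2 * C * 2 ^ N) (N := N) ?_ ?_ ?_ ?_ ?_
  · obtain ⟨A, hA⟩ := hmain
    obtain ⟨b', hb', hfin⟩ := exists_lintegral_exp_mul_sq_lt_top hX hint (A := A) (m := m) fun t => by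
      have h1 := hA (t ^ 2) (sq_nonneg t)
      rw [hGreal] at h1
      have h2 := hjensen (-t)
      have h3 := mgf_nonneg (X := X) (μ := P) (t := t)
      have h4 : mgf X P t * Real.exp (-t * m) ≤ Real.exp (A * t ^ 2) :=
        (mul_le_mul_of_nonneg_left h2 h3).trans h1
      rw [neg_mul, Real.exp_neg, ← div_eq_mul_inv, div_le_iff₀ (Real.exp_pos _),
        ← Real.exp_add] at h4
      rwa [mul_comm m t]
    exact hfin.ne (h₂ b' hb')
  · have := hGF 0
    simpa [hf1] using this
  · intro w hw
    obtain ⟨z, rfl⟩ := hsqrt w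
    rw [hGF] at hw
    have hre : z.re = 0 := by
      rcases mul_eq_zero.1 hw with h | h
      · exact hf0 z h
      · simpa using hf0 _ h
    have him : z.im ≠ 0 := by
      intro h
      have hz0 : z = 0 := Complex.ext hre h
      rw [hz0] at hw
      simp [hf1] at hw
    refine ⟨z.im ^ 2, by positivity, ?_⟩
    have : z = z.im * Complex.I := by
      apply Complex.ext <;> simp [hre]
    conv_lhs => rw [this]
    rw [mul_pow, Complex.I_sq]
    push_cast; ring
  · intro w
    obtain ⟨z, rfl⟩ := hsqrt w
    refine (hGnorm z).trans ?_
    have h1 : |z.re| ≤ 1 + 2 * ‖z ^ 2‖ := by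
      rw [norm_pow]
      have := Complex.abs_re_le_norm z
      nlinarith [sq_nonneg (‖z‖ - 1), norm_nonneg z]
    have h2 : (1 + |z.re|) ^ N ≤ 2 ^ N * (1 + ‖z ^ 2‖) ^ N := by
      rw [← mul_pow]
      gcongr
      linarith
    calc _ ≤ Real.exp (C * (1 + |z.re|) ^ N) * Real.exp (C * (1 + |z.re|) ^ N) := by
          have e1 := hmgf z.re
          have e2 := hmgf (-z.re)
          rw [abs_neg] at e2
          have := mgf_nonneg (X := X) (μ := P) (t := -z.re)
          gcongr
      _ = Real.exp (2 * C * (1 + |z.re|) ^ N) := by rw [← Real.exp_add]; ring_nf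
      _ ≤ _ := by
        rw [Real.exp_le_exp, mul_assoc (2 * C)]
        gcongr
  · intro r hr
    have h := hGreal (Real.sqrt r)
    rw [Real.sq_sqrt hr] at h
    rw [h]
    calc (1 : ℝ) = Real.exp (Real.sqrt r * m) * Real.exp (-Real.sqrt r * m) := by
          rw [← Real.exp_add]; simp
      _ ≤ _ := mul_le_mul (hjensen _) (hjensen _) (Real.exp_pos _).le mgf_nonneg
  · intro r β hr
    -- The square root of r e^{2iβ} has real part √r cos β, whose square is r cos²β; this is the
    -- source of the ridge property.
    have h1 := hGnorm (Real.sqrt r * Complex.exp (β * Complex.I))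
    have h2 := hGreal (Real.sqrt r * Real.cos β)
    have hre : (Real.sqrt r * Complex.exp (β * Complex.I)).re = Real.sqrt r * Real.cos β := by
      rw [Complex.re_ofReal_mul, Complex.exp_ofReal_mul_I_re]
    have hsq : (Real.sqrt r * Complex.exp (β * Complex.I)) ^ 2 =
        r * Complex.exp ((2 * β : ℝ) * Complex.I) := by
      rw [mul_pow, ← Complex.ofReal_pow, Real.sq_sqrt hr, ← Complex.exp_nat_mul]
      push_cast; ring_nf
    rwa [hre, ← h2, hsq, mul_pow, Real.sq_sqrt hr] at h1
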